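/- \textbf{Theorem (Coverage).} Let $K\in\mathbb{N}$, $\alpha>2$ and $\beta>0$. For each tier $k\in\{1,\dots,K\}$ let $\lambda_k>0$ (density), $\rho_k\in[0,1]$ (availability), $P_k>0$ (transmit power), and let the base stations (BSs) of tier $k$ be located at the points $x_{k,1},x_{k,2},\dots$ of a homogeneous Poisson point process of density $\lambda_k$ in $\mathbb{R}^2$. BS $(k,i)$ is available with probability $\rho_k$, and its channel to a typical user at the origin has a Rayleigh fading gain $h_{k,i}\sim\exp(1)$ and a shadowing gain $\mathcal{X}_{k,i}\ge 0$ whose law depends only on $k$, is otherwise arbitrary, and satisfies $\mathbb{E}[\mathcal{X}_{k,i}^{2/\alpha}]<\infty$. The $K$ Poisson processes, all availability states, all fading gains and all shadowing gains are mutually independent. Assume that for at least one tier $k$ one has $\rho_k>0$ and $\mathbb{P}(\mathcal{X}_{k,i}>0)>0$. In each tier the candidate BS is the available BS maximizing $P_k\mathcal{X}_{k,i}\|x_{k,i}\|^{-\alpha}$, and the user is served by the candidate, over all tiers, for which this quantity is largest. The signal-to-interference ratio (no noise) when served by BS $(k,i)$ is \[ \mathtt{SIR}(k,i)=\frac{P_k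 h_{k,i}\mathcal{X}_{k,i}\|x_{k,i}\|^{-\alpha}}{\sum_{(j,l)\neq(k,i),\ (j,l)\text{ available}}P_j h_{j,l}\mathcal{X}_{j,l}\|x_{j,l}\|^{-\alpha}} . \] Then almost surely the serving BS $b^*$ exists and is unique, and the coverage probability is \[ \mathtt{P_c}=\mathbb{P}\bigl(\mathtt{SIR}(b^*)>\beta\bigr)=\frac{1}{1+\mathcal{F}(\beta,\alpha)},\qquad \mathcal{F}(\beta,\alpha)=\frac{2\beta}{\alpha-2}\;{}_2F_1\Bigl[1,1-\tfrac{2}{\alpha};2-\tfrac{2}{\alpha};-\beta\Bigr], \] where ${}_2F_1[a,b;c;z]=\frac{\Gamma(c)}{\Gamma(b)\Gamma(c-b)}\int_0^1\frac{t^{b-1}(1-t)^{c-b-1}}{(1-tz)^a}\,dt$ is the Gauss hypergeometric function. In particular $\mathtt{P_c}$ does not depend on the densities, availabilities, powers or shadowing laws. -/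

import Mathlib

open MeasureTheory ProbabilityTheory
open scoped NNReal ENNReal

/-- The plane in which base stations (BSs) and users live. -/
abbrev Plane : Type := EuclideanSpace ℝ (Fin 2)

section PoissonProcess

variable {Ω : Type*} [MeasurableSpace Ω]

/-- The number of points (with multiplicity) of the random sequence `X` lying in `A`. -/
noncomputable def pointCount (X : ℕ → Ω → Plane) (A : Set Plane) (ω : Ω) : ℕ∞ :=
  {i : ℕ | X i ω ∈ A}.encard

/-- The random sequence `X` enumerates the points of a homogeneous Poisson point process of
density `dens` in the plane: the number of points in a Borel set of finite area is Poisson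
with mean `dens` times the area, and the numbers of points in disjoint Borel sets are
independent. (A process of positive density has infinitely many points almost surely, so it can
be enumerated by `ℕ`.) -/
structure IsHomogeneousPPP (X : ℕ → Ω → Plane) (dens : ℝ≥0) (P : Measure Ω) : Prop where
  measurable : ∀ i, Measurable (X i)
  count_law : ∀ A : Set Plane, MeasurableSet A → volume A ≠ ∞ → ∀ n : ℕ,
    P {ω | pointCount X A ω = n} = poissonMeasure (dens * (volume A).toNNReal) {n}
  count_indep : ∀ (m : ℕ) (A : Fin m → Set Plane), (∀ j, MeasurableSet (A j)) →
    Pairwise (fun j l => Disjoint (A j) (A l)) →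
    iIndepFun (fun j => pointCount X (A j)) P

end PoissonProcess

/-- The data of a `K`-tier cellular network seen from a typical user at the origin.
A BS is addressed by a pair `(k, i)`: the `i`-th BS of tier `k`. -/
structure HetNet (K : ℕ) (Ω : Type*) where
  /-- density of all BSs of a tier -/
  density : Fin K → ℝ≥0
  /-- availability of the BSs of a tier -/
  avail : Fin K → ℝ
  /-- transmit power of a tier -/
  power : Fin K → ℝ
  /-- law of the shadowing gain of a tier -/
  shadowLaw : Fin K → Measure ℝ
  /-- path loss exponent -/
  α : ℝ
  /-- location of a BS -/
  loc : Fin K → ℕ → Ω → Plane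
  /-- whether a BS is available -/
  on : Fin K → ℕ → Ω → Bool
  /-- small scale fading gain from a BS to the origin -/
  fading : Fin K → ℕ → Ω → ℝ
  /-- shadowing gain from a BS to the origin -/
  shadow : Fin K → ℕ → Ω → ℝ

namespace HetNet

/-- Labels for the independent sources of randomness of the network. -/
inductive Source (K : ℕ) : Type
  | locations (k : Fin K)
  | state (k : Fin K) (i : ℕ)
  | fading (k : Fin K) (i : ℕ)
  | shadowing (k : Fin K) (i : ℕ)

variable {K : ℕ} {Ω : Type*}

/-- The σ-algebra generated by a source of randomness. -/
@[reducible] def sourceSigma (N : HetNet K Ω) : Source K → MeasurableSpace Ω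
  | .locations k => MeasurableSpace.comap (fun ω i => N.loc k i ω) inferInstance
  | .state k i => MeasurableSpace.comap (N.on k i) inferInstance
  | .fading k i => MeasurableSpace.comap (N.fading k i) inferInstance
  | .shadowing k i => MeasurableSpace.comap (N.shadow k i) inferInstance

/-- The probabilistic assumptions of the model: independent homogeneous Poisson tiers, BSs that
are available independently with the availability of their tier, Rayleigh fading, and shadowing
with an arbitrary law on `[0, ∞)` having a finite moment of order `2 / α`. -/
structure IsModel [MeasurableSpace Ω] (N : HetNet K Ω) (P : Measure Ω) : Prop where
  density_pos : ∀ k, 0 < N.density k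
  avail_mem : ∀ k, N.avail k ∈ Set.Icc (0 : ℝ) 1
  power_pos : ∀ k, 0 < N.power k
  two_lt_α : 2 < N.α
  shadowLaw_nonneg : ∀ k, ∀ᵐ s ∂N.shadowLaw k, 0 ≤ s
  shadowLaw_moment : ∀ k, Integrable (fun s : ℝ => s ^ (2 / N.α)) (N.shadowLaw k)
  loc_ppp : ∀ k, IsHomogeneousPPP (N.loc k) (N.density k) P
  on_measurable : ∀ k i, Measurable (N.on k i)
  on_prob : ∀ k i, P {ω | N.on k i ω = true} = ENNReal.ofReal (N.avail k)
  fading_measurable : ∀ k i, Measurable (N.fading k i)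
  fading_law : ∀ k i, P.map (N.fading k i) = expMeasure 1
  shadow_measurable : ∀ k i, Measurable (N.shadow k i)
  shadow_law : ∀ k i, P.map (N.shadow k i) = N.shadowLaw k
  indep : iIndep N.sourceSigma P

/-- Long term power received at the origin from BS `(k, i)` (no small scale fading). -/
noncomputable def avgPower (N : HetNet K Ω) (ω : Ω) (k : Fin K) (i : ℕ) : ℝ :=
  N.power k * N.shadow k i ω * ‖N.loc k i ω‖ ^ (-N.α)

/-- Instantaneous power received at the origin from BS `(k, i)`. -/
noncomputable def rxPower (N : HetNet K Ω) (ω : Ω) (k : Fin K) (i : ℕ) : ℝ :=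
  N.power k * N.fading k i ω * N.shadow k i ω * ‖N.loc k i ω‖ ^ (-N.α)

/-- `(k, i)` is the candidate serving BS of tier `k`: it maximizes the long term received power
among the available BSs of tier `k`. -/
def IsCandidate (N : HetNet K Ω) (ω : Ω) (k : Fin K) (i : ℕ) : Prop :=
  N.on k i ω = true ∧ ∀ j, N.on k j ω = true → N.avgPower ω k j ≤ N.avgPower ω k i

/-- `b` is the serving BS: the best of the candidates of all tiers. -/
def IsServing (N : HetNet K Ω) (ω : Ω) (b : Fin K × ℕ) : Prop :=
  N.IsCandidate ω b.1 b.2 ∧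
    ∀ (l : Fin K) (j : ℕ), N.IsCandidate ω l j → N.avgPower ω l j ≤ N.avgPower ω b.1 b.2

/-- Interference at the origin when served by `b`: total power from all other available BSs. -/
noncomputable def interference (N : HetNet K Ω) (ω : Ω) (b : Fin K × ℕ) : ℝ≥0∞ :=
  ∑ k : Fin K, ∑' i : {i : ℕ // N.on k i ω = true ∧ (k, i) ≠ b}, ENNReal.ofReal (N.rxPower ω k i)

/-- Signal-to-interference ratio at the origin when served by `b`. -/
noncomputable def SIR (N : HetNet K Ω) (ω : Ω) (b : Fin K × ℕ) : ℝ≥0∞ :=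
  ENNReal.ofReal (N.rxPower ω b.1 b.2) / N.interference ω b

/-- The event that the typical user is covered: the SIR from its serving BS exceeds `β`. -/
def coverageEvent (N : HetNet K Ω) (β : ℝ) : Set Ω :=
  {ω | ∃ b, N.IsServing ω b ∧ ENNReal.ofReal β < N.SIR ω b}

end HetNet

/-- Gauss hypergeometric function, by Euler's integral (for `0 < b < c` and `z < 1`). -/
noncomputable def gaussHyp (a b c z : ℝ) : ℝ :=
  Real.Gamma c / (Real.Gamma b * Real.Gamma (c - b)) *
    ∫ t in (0 : ℝ)..1, t ^ (b - 1) * (1 - t) ^ (c - b - 1) / (1 - t * z) ^ a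

/-- The function `F(β, α)` of the coverage formula. -/
noncomputable def coverageF (β α : ℝ) : ℝ :=
  2 * β / (α - 2) * gaussHyp 1 (1 - 2 / α) (2 - 2 / α) (-β)

/-! ### Infinite products of factors in `[0, 1]`. -/

section InfProd

open Filter Topology

/-! Put γ = α/2. The average powers of the available BSs form a Poisson process on (0, ∞), the image
of c times Lebesgue measure under v ↦ v^(-γ): the substitution v ∝ ‖x‖² turns area into length, and
densities, availabilities, transmit powers and shadowing moments enter only through c
(`isPowerLawPPP_activePower`). The SIR does not change when all powers are rescaled, and rescaling
absorbs c, so the answer can depend on α and β only.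

Given the powers, with maximum p_b, exponential fading at the serving BS makes the conditional
coverage probability E[exp(-β I / p_b)], where I is the interference. Averaging over the other
fadings turns it into the product over l ≠ b of 1/(1 + β p_l/p_b) (`measure_argmax_inter_lt`).
Including l = b costs a factor 1 + β, so what remains is E[T] for the full product T = ∏ 1/(1 + β
p_l/p_max).

E[T] is found without conditioning on the largest point (`lintegral_infProd_expFactor_argmax`). Let
m = p_max^(-1/γ) and, for a, u > 0, let Φ_a(u) = E[1{a u ≤ m} ∏ 1/(1 + β u^γ p_l)]. The indicator is
itself a product over the points, so the Laplace functional gives Φ_a(u) = exp(-c H(a) u) with H(a)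
= a + ∫_a^∞ β/(w^γ + β) dw. For a < b, Φ_a - Φ_b only sees u in (m/b, m/a]. Integrated against du/u
it is about E[T] log(b/a) when a and b are near 1, whereas the exponentials give log(H(b)/H(a)).
Hence E[T] = H'(1)/H(1) = 1/((1 + β) H(1)), and c has disappeared. The coverage probability is
therefore 1/H(1), and H(1) = 1 + F(β, α) is Euler's integral (`tailIntegral_one_eq`).

Existence and uniqueness of the serving BS come from the same Laplace functional, through generating
functions of point counts: there are finitely many points above any positive level, at least one
positive point, and no ties (`ae_exists_strict_argmax`). -/

/-- The product of a family of factors in `[0, 1]`, as the infimum of the finite products. -/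
noncomputable def infProd {ι : Type*} (a : ι → ℝ≥0∞) : ℝ≥0∞ := ⨅ s : Finset ι, ∏ i ∈ s, a i

variable {ι κ : Type*} {a b : ι → ℝ≥0∞}

lemma infProd_le_prod (a : ι → ℝ≥0∞) (s : Finset ι) : infProd a ≤ ∏ i ∈ s, a i := iInf_le _ s

lemma infProd_le (a : ι → ℝ≥0∞) (i : ι) : infProd a ≤ a i := by
  simpa using infProd_le_prod a {i}

lemma infProd_le_one (a : ι → ℝ≥0∞) : infProd a ≤ 1 := by
  simpa using infProd_le_prod a ∅

lemma infProd_mono (h : ∀ i, a i ≤ b i) : infProd a ≤ infProd b :=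
  iInf_mono fun _ => Finset.prod_le_prod' fun i _ => h i

lemma infProd_eq_zero {i : ι} (h : a i = 0) : infProd a = 0 :=
  le_antisymm ((infProd_le a i).trans h.le) zero_le

lemma antitone_prod_of_le_one (ha : ∀ i, a i ≤ 1) :
    Antitone fun s : Finset ι => ∏ i ∈ s, a i := by
  intro s t hst
  exact Finset.prod_le_prod_of_subset_of_le_one' hst fun i _ _ => ha i

lemma tendsto_infProd (ha : ∀ i, a i ≤ 1) :
    Tendsto (fun s : Finset ι => ∏ i ∈ s, a i) atTop (𝓝 (infProd a)) :=
  tendsto_atTop_iInf (antitone_prod_of_le_one ha)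

lemma infProd_mul (ha : ∀ i, a i ≤ 1) (hb : ∀ i, b i ≤ 1) :
    infProd (fun i => a i * b i) = infProd a * infProd b := by
  have h := tendsto_infProd (a := fun i => a i * b i) fun i => mul_le_one' (ha i) (hb i)
  have h' := ENNReal.Tendsto.mul (tendsto_infProd ha)
    (Or.inr (ne_top_of_le_ne_top ENNReal.one_ne_top (infProd_le_one b))) (tendsto_infProd hb)
    (Or.inr (ne_top_of_le_ne_top ENNReal.one_ne_top (infProd_le_one a)))
  simp only [Finset.prod_mul_distrib] at h
  exact tendsto_nhds_unique h h'

lemma infProd_of_forall_notMem (s : Finset ι) (ha : ∀ i, a i ≤ 1) (h : ∀ i ∉ s, a i = 1) :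
    infProd a = ∏ i ∈ s, a i := by
  classical
  refine le_antisymm (infProd_le_prod a s) (le_iInf fun t => ?_)
  have : ∏ i ∈ s ∪ t, a i = ∏ i ∈ s, a i :=
    (Finset.prod_subset Finset.subset_union_left fun i _ hi => h i hi).symm
  rw [← this]
  exact antitone_prod_of_le_one ha Finset.subset_union_right

lemma infProd_one : infProd (fun _ : ι => (1 : ℝ≥0∞)) = 1 := by
  simp [infProd]

lemma infProd_ite_eq [DecidableEq ι] (i : ι) {c : ℝ≥0∞} (hc : c ≤ 1) :
    infProd (fun j => if j = i then c else 1) = c := by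
  rw [infProd_of_forall_notMem {i}]
  · simp
  · intro j; split_ifs <;> simp [hc]
  · intro j hj; simp at hj; simp [hj]

/-- Splitting off one factor. -/
lemma infProd_eq_mul [DecidableEq ι] (i : ι) (ha : ∀ i, a i ≤ 1) :
    infProd a = a i * infProd (fun j => if j = i then 1 else a j) := by
  conv_rhs => rw [← infProd_ite_eq i (ha i)]
  rw [← infProd_mul]
  · congr 1; ext j; by_cases h : j = i <;> simp [h]
  · intro j; split_ifs <;> simp [ha]
  · intro j; split_ifs <;> simp [ha]

lemma tendsto_finset_prod_of_le_one {β : Type*} {l : Filter β} (s : Finset ι)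
    {f : ι → β → ℝ≥0∞} (ha : ∀ i, a i ≤ 1) (h : ∀ i, Tendsto (f i) l (𝓝 (a i))) :
    Tendsto (fun x => ∏ i ∈ s, f i x) l (𝓝 (∏ i ∈ s, a i)) := by
  classical
  induction s using Finset.induction_on with
  | empty => simpa using tendsto_const_nhds
  | insert i s hi ih =>
    simp only [Finset.prod_insert hi]
    refine ENNReal.Tendsto.mul (h i) (Or.inr ?_) ih (Or.inr ?_)
    · exact ne_top_of_le_ne_top ENNReal.one_ne_top (Finset.prod_le_one' fun i _ => ha i)
    · exact ne_top_of_le_ne_top ENNReal.one_ne_top (ha i)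

lemma infProd_prod [Fintype κ] {a : κ × ι → ℝ≥0∞} (ha : ∀ i, a i ≤ 1) :
    infProd a = ∏ k, infProd fun i => a (k, i) := by
  classical
  refine le_antisymm ?_ (le_iInf fun s => ?_)
  · have h := tendsto_finset_prod_of_le_one Finset.univ
      (a := fun k : κ => infProd fun i => a (k, i)) (fun k => infProd_le_one _)
      (fun k => tendsto_infProd (a := fun i => a (k, i)) fun i => ha (k, i))
    refine ge_of_tendsto h (Eventually.of_forall fun s => ?_)
    have := infProd_le_prod a (Finset.univ ×ˢ s)
    rwa [Finset.prod_product] at this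
  · have hs : s ⊆ Finset.univ ×ˢ s.image Prod.snd := by
      intro x hx
      simp only [Finset.mem_product, Finset.mem_univ, true_and, Finset.mem_image]
      exact ⟨x, hx, rfl⟩
    refine le_trans ?_ (antitone_prod_of_le_one ha hs)
    simp only [Finset.prod_product]
    exact Finset.prod_le_prod' fun k _ => infProd_le_prod (fun i => a (k, i)) _

/-- Both sides are iterated infima once a decreasing limit is moved inside a finite product, which
continuity allows for factors at most 1. -/
lemma iInf_infProd {a : ℕ → ι → ℝ≥0∞} (ha : ∀ n i, a n i ≤ 1) (hm : ∀ i, Antitone fun n => a n i) :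
    ⨅ n, infProd (a n) = infProd fun i => ⨅ n, a n i := by
  unfold infProd
  rw [iInf_comm]
  congr 1; ext s
  refine tendsto_nhds_unique (tendsto_atTop_iInf ?_) (tendsto_finset_prod_of_le_one s
    (fun i => (iInf_le _ 0).trans (ha 0 i)) fun i => tendsto_atTop_iInf (hm i))
  intro m n hmn
  exact Finset.prod_le_prod' fun i _ => hm i hmn

lemma measurable_infProd [Countable ι] {α : Type*} [MeasurableSpace α] {f : ι → α → ℝ≥0∞}
    (hf : ∀ i, Measurable (f i)) : Measurable fun x => infProd fun i => f i x := by
  unfold infProd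
  exact .iInf fun s => s.measurable_prod fun i _ => hf i

/-- Monotone convergence, downwards along the directed family of finite sets. The finite integral of
`k` is what a decreasing limit needs, and it also makes `k` finite almost everywhere, so that `k x`
passes through the infimum. -/
lemma lintegral_mul_infProd [Countable ι] {α : Type*} [MeasurableSpace α] {μ : Measure α}
    {k : α → ℝ≥0∞} (hk : Measurable k) (hk' : ∫⁻ x, k x ∂μ ≠ ∞) {f : ι → α → ℝ≥0∞}
    (hf : ∀ i, Measurable (f i)) (hf1 : ∀ i x, f i x ≤ 1) :
    ∫⁻ x, k x * infProd (fun i => f i x) ∂μ = ⨅ s : Finset ι, ∫⁻ x, k x * ∏ i ∈ s, f i x ∂μ := by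
  rcases eq_or_ne μ 0 with rfl | hμ
  · simp
  have hle : ∀ s : Finset ι, ∫⁻ x, k x * ∏ i ∈ s, f i x ∂μ ≤ ∫⁻ x, k x ∂μ := fun s =>
    lintegral_mono fun x => mul_le_of_le_one_right' (Finset.prod_le_one' fun i _ => hf1 i x)
  have hfin : ∀ᵐ x ∂μ, k x ≠ ∞ := (ae_lt_top hk hk').mono fun x hx => hx.ne
  rw [← lintegral_iInf_directed_of_measurable (f := fun s x => k x * ∏ i ∈ s, f i x) hμ
    (fun s => hk.mul (s.measurable_prod fun i _ => hf i))
    (fun s => ne_top_of_le_ne_top hk' (hle s))]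
  · refine lintegral_congr_ae (hfin.mono fun x hx => ?_)
    simp only [infProd]
    rcases eq_or_ne (k x) 0 with h0 | h0
    · simp [h0]
    · rw [ENNReal.mul_iInf_of_ne h0 hx]
  · refine Antitone.directed_ge fun s t hst x => ?_
    exact mul_le_mul_right (antitone_prod_of_le_one (a := fun i => f i x) (fun i => hf1 i x) hst) _

end InfProd

/-! ### The exponential exp(-x) on `[0, ∞]`. -/

section ExpNeg

open Filter Topology

/-- The function `exp (-x)` on the extended nonnegative reals. -/
noncomputable def expNeg (x : ℝ≥0∞) : ℝ≥0∞ := EReal.exp (-(x : EReal))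

lemma expNeg_zero : expNeg 0 = 1 := by simp [expNeg]

lemma expNeg_add (x y : ℝ≥0∞) : expNeg (x + y) = expNeg x * expNeg y := by
  unfold expNeg
  rw [← EReal.exp_add, EReal.coe_ennreal_add, EReal.neg_add]
  · rfl
  · left; simp
  · right; simp

lemma expNeg_antitone : Antitone expNeg := by
  intro x y h
  exact EReal.exp_monotone (EReal.neg_le_neg_iff.2 (EReal.coe_ennreal_le_coe_ennreal_iff.2 h))

lemma expNeg_le_one (x : ℝ≥0∞) : expNeg x ≤ 1 := by
  rw [← expNeg_zero]; exact expNeg_antitone zero_le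

lemma continuous_expNeg : Continuous expNeg :=
  (show Continuous EReal.exp from ENNReal.continuous_exp).comp
    (continuous_neg.comp continuous_coe_ennreal_ereal)

lemma measurable_expNeg : Measurable expNeg := expNeg_antitone.measurable

lemma expNeg_ofReal {x : ℝ} (hx : 0 ≤ x) :
    expNeg (ENNReal.ofReal x) = ENNReal.ofReal (Real.exp (-x)) := by
  unfold expNeg
  rw [EReal.coe_ennreal_ofReal, max_eq_left hx, ← EReal.coe_neg, EReal.exp_coe]

lemma expNeg_sum {ι : Type*} (s : Finset ι) (f : ι → ℝ≥0∞) :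
    expNeg (∑ i ∈ s, f i) = ∏ i ∈ s, expNeg (f i) := by
  classical
  induction s using Finset.induction_on with
  | empty => simp [expNeg_zero]
  | insert i s hi ih => rw [Finset.sum_insert hi, Finset.prod_insert hi, expNeg_add, ih]

/-- Continuity of `expNeg` up to ∞ removes any summability condition: a divergent sum corresponds to
a vanishing product. -/
lemma expNeg_tsum {ι : Type*} (f : ι → ℝ≥0∞) :
    expNeg (∑' i, f i) = infProd fun i => expNeg (f i) := by
  have h := (continuous_expNeg.tendsto _).comp (ENNReal.summable (f := f)).hasSum
  refine tendsto_nhds_unique h ?_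
  simpa only [Function.comp_def, expNeg_sum, SummationFilter.unconditional_filter] using
    tendsto_infProd (a := fun i => expNeg (f i)) fun i => expNeg_le_one _

lemma iInf_expNeg {f : ℕ → ℝ≥0∞} (hf : Monotone f) : ⨅ n, expNeg (f n) = expNeg (⨆ n, f n) :=
  tendsto_nhds_unique (tendsto_atTop_iInf (expNeg_antitone.comp_monotone hf))
    ((continuous_expNeg.tendsto _).comp (tendsto_atTop_iSup hf))

end ExpNeg

/-! ### Integrating out independent marks. -/

section Independence

variable {Ω D E : Type*} [MeasurableSpace Ω] [MeasurableSpace D] [MeasurableSpace E]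
  {P : Measure Ω}

lemma ProbabilityTheory.IndepFun.lintegral_comp_prodMk [IsProbabilityMeasure P] {Z : Ω → D}
    {M : Ω → E} (hZ : Measurable Z) (hM : Measurable M) (h : IndepFun Z M P) {F : D × E → ℝ≥0∞}
    (hF : Measurable F) :
    ∫⁻ ω, F (Z ω, M ω) ∂P = ∫⁻ ω, ∫⁻ y, F (Z ω, y) ∂(P.map M) ∂P := by
  have := (Measure.isProbabilityMeasure_map hM.aemeasurable : IsProbabilityMeasure (P.map M))
  have h1 := (indepFun_iff_map_prod_eq_prod_map_map hZ.aemeasurable hM.aemeasurable).1 h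
  rw [← lintegral_map hF (hZ.prodMk hM), h1, lintegral_prod _ hF.aemeasurable,
    lintegral_map hF.lintegral_prod_right' hZ]

/-- Averaging an infinite product over independent marks, given the remaining randomness. -/
lemma lintegral_infProd_of_indepFun [IsProbabilityMeasure P] {ι : Type*} [Countable ι]
    {Z : Ω → D} {M : ι → Ω → E} (hZ : Measurable Z) (hM : ∀ i, Measurable (M i))
    (hZM : IndepFun Z (fun ω i => M i ω) P) (hMi : iIndepFun M P)
    {k : D → ℝ≥0∞} (hk : Measurable k) (hk1 : ∀ z, k z ≤ 1)
    {g : ι → D × E → ℝ≥0∞} (hg : ∀ i, Measurable (g i)) (hg1 : ∀ i z, g i z ≤ 1) :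
    ∫⁻ ω, k (Z ω) * infProd (fun i => g i (Z ω, M i ω)) ∂P =
      ∫⁻ ω, k (Z ω) * infProd (fun i => ∫⁻ y, g i (Z ω, y) ∂(P.map (M i))) ∂P := by
  have hpr : ∀ i, IsProbabilityMeasure (P.map (M i)) := fun i =>
    Measure.isProbabilityMeasure_map (hM i).aemeasurable
  have hkP : ∫⁻ ω, k (Z ω) ∂P ≠ ∞ := by
    refine ne_top_of_le_ne_top ENNReal.one_ne_top ((lintegral_mono fun ω => hk1 _).trans ?_)
    simp
  have hG : ∀ i, Measurable fun z => ∫⁻ y, g i (z, y) ∂(P.map (M i)) := fun i =>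
    (hg i).lintegral_prod_right'
  rw [lintegral_mul_infProd (k := fun ω => k (Z ω)) (f := fun i ω => g i (Z ω, M i ω))
      (hk.comp hZ) hkP (fun i => (hg i).comp (hZ.prodMk (hM i))) (fun i _ => hg1 i _),
    lintegral_mul_infProd (k := fun ω => k (Z ω))
      (f := fun i ω => ∫⁻ y, g i (Z ω, y) ∂(P.map (M i))) (hk.comp hZ) hkP (fun i => (hG i).comp hZ)]
  -- With the infimum over finite sets outside both integrals, Fubini and independence are needed
  -- only for a finite product.
  · congr 1; ext s
    have hmeas : Measurable fun x : D × (ι → E) => k x.1 * ∏ i ∈ s, g i (x.1, x.2 i) :=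
      (hk.comp measurable_fst).mul (s.measurable_prod fun i _ => (hg i).comp
        (measurable_fst.prodMk ((measurable_pi_apply i).comp measurable_snd)))
    have hMM : Measurable fun ω i => M i ω := measurable_pi_lambda _ hM
    rw [hZM.lintegral_comp_prodMk hZ hMM hmeas]
    refine lintegral_congr fun ω => ?_
    have h2 : Measurable fun m : ι → E => ∏ i ∈ s, g i (Z ω, m i) :=
      s.measurable_prod fun i _ => (hg i).comp (measurable_const.prodMk (measurable_pi_apply i))
    simp only
    rw [lintegral_const_mul _ h2, lintegral_map h2 hMM]
    congr 1
    have h3 : ∀ i, Measurable fun y => g i (Z ω, y) := fun i =>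
      (hg i).comp (measurable_const.prodMk measurable_id)
    rw [lintegral_prod_eq_prod_lintegral_of_indepFun s (fun i ω' => g i (Z ω, M i ω'))
      (hMi.comp (fun i y => g i (Z ω, y)) h3) fun i => (h3 i).comp (hM i)]
    exact Finset.prod_congr rfl fun i _ => (lintegral_map (h3 i) (hM i)).symm
  · intro i ω
    refine (lintegral_mono fun y => hg1 i _).trans ?_
    simp

end Independence

/-! ### Laplace functional of a homogeneous Poisson process. -/

section Laplace

open Filter Topology

variable {Ω : Type*} [MeasurableSpace Ω] {P : Measure Ω} {X : ℕ → Ω → Plane} {dens : ℝ≥0}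

/-- `c ^ n` for `c ≤ 1` and `n` possibly infinite, as a product of `n` factors. -/
noncomputable def encardPow (c : ℝ≥0∞) (n : ℕ∞) : ℝ≥0∞ :=
  if n = ⊤ then (if c = 1 then 1 else 0) else c ^ n.toNat

lemma encardPow_natCast (c : ℝ≥0∞) (n : ℕ) : encardPow c n = c ^ n := by
  simp [encardPow]

lemma infProd_ite_mem {ι : Type*} (s : Set ι) [DecidablePred (· ∈ s)] {c : ℝ≥0∞} (hc : c ≤ 1) :
    infProd (fun i => if i ∈ s then c else 1) = encardPow c s.encard := by
  classical
  rcases s.finite_or_infinite with hs | hs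
  · rw [hs.encard_eq_coe_toFinset_card, encardPow_natCast, infProd_of_forall_notMem hs.toFinset]
    · rw [Finset.prod_congr rfl (g := fun _ => c)]
      · simp
      · intro i hi; simp at hi; simp [hi]
    · intro i; split_ifs <;> simp [hc]
    · intro i hi; simp at hi; simp [hi]
  · rw [hs.encard_eq]
    rcases eq_or_ne c 1 with rfl | h1
    · simp [encardPow, infProd_one]
    · have hlt : c < 1 := lt_of_le_of_ne hc h1
      simp only [encardPow, if_true, if_neg h1]
      refine le_antisymm (ge_of_tendsto (ENNReal.tendsto_pow_atTop_nhds_zero_of_lt_one hlt)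
        (Eventually.of_forall fun n => ?_)) zero_le
      obtain ⟨t, ht, hn⟩ := hs.exists_subset_card_eq n
      refine (infProd_le_prod _ t).trans ?_
      rw [Finset.prod_congr rfl (g := fun _ => c)]
      · simp [hn]
      · intro i hi; simp [ht hi]

lemma tsum_pow_mul_poissonMeasure (r : ℝ≥0) {c : ℝ≥0∞} (hc : c ≤ 1) :
    ∑' n : ℕ, c ^ n * poissonMeasure r {n} = expNeg (r * (1 - c)) := by
  lift c to ℝ≥0 using ne_top_of_le_ne_top ENNReal.one_ne_top hc
  have hc' : (c : ℝ) ≤ 1 := by exact_mod_cast hc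
  have h := NormedSpace.expSeries_div_hasSum_exp (𝔸 := ℝ) (c * r : ℝ)
  rw [← Real.exp_eq_exp_ℝ] at h
  have h2 := h.mul_left (Real.exp (-r))
  rw [← Real.exp_add] at h2
  have e1 : ∀ n : ℕ, (c : ℝ≥0∞) ^ n * poissonMeasure r {n} =
      ENNReal.ofReal (Real.exp (-r) * ((c * r : ℝ) ^ n / n.factorial)) := by
    intro n
    rw [poissonMeasure_singleton, ← ENNReal.ofReal_coe_nnreal, ← ENNReal.ofReal_pow (by positivity),
      ← ENNReal.ofReal_mul (by positivity)]
    congr 1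
    rw [mul_pow]; ring
  simp_rw [e1]
  rw [← ENNReal.ofReal_tsum_of_nonneg (fun n => by positivity) h2.summable, h2.tsum_eq]
  have e2 : (r : ℝ≥0∞) * (1 - c) = ENNReal.ofReal (r * (1 - c)) := by
    rw [ENNReal.ofReal_mul (by positivity), ENNReal.ofReal_sub _ (by positivity)]
    simp
  rw [e2, expNeg_ofReal (mul_nonneg r.coe_nonneg (by linarith))]
  congr 2; ring

lemma measurable_pointCount (hX : ∀ i, Measurable (X i)) {A : Set Plane} (hA : MeasurableSet A) :
    Measurable (pointCount X A) := by
  refine measurable_encard.comp (measurable_set_iff.2 fun i => ?_)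
  exact measurable_mem.2 (hX i hA)

/-- The generating function of a Poisson count. Infinite area is allowed when `c = 1`: the level set
of the value 1 of a test function usually has infinite area, and its points contribute nothing. -/
lemma IsHomogeneousPPP.lintegral_encardPow [IsProbabilityMeasure P]
    (hX : IsHomogeneousPPP X dens P) {A : Set Plane}
    (hA : MeasurableSet A) {c : ℝ≥0∞} (hc : c ≤ 1) (hAc : c ≠ 1 → volume A ≠ ∞) :
    ∫⁻ ω, encardPow c (pointCount X A ω) ∂P = expNeg (dens * ((1 - c) * volume A)) := by
  rcases eq_or_ne c 1 with rfl | h1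
  · have : ∀ n, encardPow 1 n = 1 := by intro n; simp [encardPow]
    simp [this, expNeg_zero]
  have hA' := hAc h1
  have hm := measurable_pointCount hX.measurable hA
  rw [← lintegral_map (f := encardPow c) (g := pointCount X A) .of_discrete hm]
  have hsing : ∀ n : ℕ, P.map (pointCount X A) {(n : ℕ∞)} =
      poissonMeasure (dens * (volume A).toNNReal) {n} := by
    intro n
    rw [Measure.map_apply hm (measurableSet_singleton _)]
    exact hX.count_law A hA hA' n
  -- The Poisson weights already sum to 1, so the count is almost surely finite.
  have hrange : ∑' n : ℕ, P.map (pointCount X A) {(n : ℕ∞)} = 1 := by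
    simp_rw [hsing]
    have := tsum_pow_mul_poissonMeasure (dens * (volume A).toNNReal) (c := 1) le_rfl
    simpa [expNeg_zero] using this
  have htop : P.map (pointCount X A) {⊤} = 0 := by
    have hpm : IsProbabilityMeasure (P.map (pointCount X A)) :=
      Measure.isProbabilityMeasure_map hm.aemeasurable
    have hU : P.map (pointCount X A) (Set.range ((↑) : ℕ → ℕ∞)) = 1 := by
      rw [← hrange, ← Set.iUnion_singleton_eq_range,
        measure_iUnion (fun i j hij => by simpa using hij) fun n => measurableSet_singleton _]
    have := (prob_compl_eq_zero_iff (μ := P.map (pointCount X A)) (s := Set.range ((↑) : ℕ → ℕ∞))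
      .of_discrete).2 hU
    refine measure_mono_null ?_ this
    rintro x rfl
    simp
  rw [lintegral_countable']
  have hinj : Function.Injective ((↑) : ℕ → ℕ∞) := Nat.cast_injective
  rw [← hinj.tsum_eq]
  · simp_rw [hsing, encardPow_natCast]
    rw [tsum_pow_mul_poissonMeasure _ hc]
    congr 1
    rw [ENNReal.coe_mul, ENNReal.coe_toNNReal hA']; ring
  · intro x hx
    induction x using ENat.recTopCoe with
    | top => simp [htop] at hx
    | coe n => exact ⟨n, rfl⟩

/-- The product over points regroups by the level sets of `g`, which are disjoint. Their counts are
independent, so the expectation factors into generating functions whose exponents add up to the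
integral of `1 - g`. -/
lemma IsHomogeneousPPP.lintegral_infProd_simpleFunc [IsProbabilityMeasure P]
    (hX : IsHomogeneousPPP X dens P) (g : SimpleFunc Plane ℝ≥0∞) (hg : ∀ x, g x ≤ 1)
    (hfin : ∀ c, c ≠ 1 → volume (g ⁻¹' {c}) ≠ ∞) :
    ∫⁻ ω, infProd (fun i => g (X i ω)) ∂P = expNeg (dens * ∫⁻ x, 1 - g x) := by
  classical
  set m := g.range.card
  let e : Fin m ≃ g.range := (Finset.equivFin g.range).symm
  let c : Fin m → ℝ≥0∞ := fun j => (e j : ℝ≥0∞)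
  have hc : ∀ j, c j ≤ 1 := fun j => by
    obtain ⟨x, hx⟩ := SimpleFunc.mem_range.1 (e j).2
    rw [show c j = g x from hx.symm]; exact hg x
  let A : Fin m → Set Plane := fun j => g ⁻¹' {c j}
  have hA : ∀ j, MeasurableSet (A j) := fun j => g.measurableSet_preimage _
  have hdisj : Pairwise fun j l => Disjoint (A j) (A l) := by
    intro j l hjl
    refine Disjoint.preimage _ ?_
    rw [Set.disjoint_singleton]
    intro h
    exact hjl (e.injective (Subtype.ext h))
  have hsum : ∀ F : ℝ≥0∞ → ℝ≥0∞, ∑ y ∈ g.range, F y = ∑ j, F (c j) := by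
    intro F
    rw [← Finset.sum_coe_sort g.range F, ← e.sum_comp]
  have h1 : ∀ ω, infProd (fun i => g (X i ω)) = ∏ j, encardPow (c j) (pointCount X (A j) ω) := by
    intro ω
    have : ∀ i, g (X i ω) = ∏ j, (if X i ω ∈ A j then c j else 1) := by
      intro i
      obtain ⟨j, hj⟩ := e.surjective ⟨g (X i ω), g.mem_range_self _⟩
      have hj' : c j = g (X i ω) := by simp [c, hj]
      rw [Finset.prod_eq_single j]
      · simp [A, hj']
      · intro l _ hl
        rw [if_neg]
        intro hmem
        exact (Set.disjoint_left.1 (hdisj hl) hmem) (by simp [A, hj'])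
      · simp
    simp_rw [this]
    have key : ∀ s : Finset (Fin m), infProd (fun i => ∏ j ∈ s, if X i ω ∈ A j then c j else 1) =
        ∏ j ∈ s, encardPow (c j) (pointCount X (A j) ω) := by
      intro s
      induction s using Finset.induction_on with
      | empty => simp [infProd_one]
      | insert a s ha ih =>
        simp only [Finset.prod_insert ha]
        rw [infProd_mul, ih]
        · congr 1
          exact infProd_ite_mem {i | X i ω ∈ A a} (hc a)
        · intro i; split_ifs <;> simp [hc]
        · intro i; refine Finset.prod_le_one' fun j _ => ?_
          split_ifs <;> simp [hc]
    exact key Finset.univ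
  simp_rw [h1]
  have hind := (hX.count_indep m A hA hdisj).comp (fun j => encardPow (c j)) fun j => .of_discrete
  have h2 := lintegral_prod_eq_prod_lintegral_of_indepFun Finset.univ _ hind fun j =>
    Measurable.of_discrete.comp (measurable_pointCount hX.measurable (hA j))
  simp only [Function.comp_apply] at h2
  rw [h2]
  simp_rw [hX.lintegral_encardPow (hA _) (hc _) (hfin _)]
  rw [← expNeg_sum, ← Finset.mul_sum]
  congr 2
  have h3 := hsum fun y => (1 - y) * volume (g ⁻¹' {y})
  rw [← h3]
  have h4 := SimpleFunc.map_lintegral (μ := volume) (fun y => 1 - y) g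
  rw [← h4, ← SimpleFunc.lintegral_eq_lintegral]
  rfl

/-- The Laplace functional of a homogeneous Poisson point process. -/
theorem IsHomogeneousPPP.lintegral_infProd [IsProbabilityMeasure P]
    (hX : IsHomogeneousPPP X dens P) {g : Plane → ℝ≥0∞} (hgm : Measurable g) (hg : ∀ x, g x ≤ 1) :
    ∫⁻ ω, infProd (fun i => g (X i ω)) ∂P = expNeg (dens * ∫⁻ x, 1 - g x) := by
  have hfm : Measurable fun x => 1 - g x := measurable_const.sub hgm
  let B : ℕ → Set Plane := fun n => Metric.ball 0 n
  have hB : ∀ n, MeasurableSet (B n) := fun n => Metric.isOpen_ball.measurableSet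
  -- Approximating `1 - g` from below and cutting it off to a ball keeps every level set of `1 - f
  -- n`, except that of the value 1, inside a set of finite area.
  let f : ℕ → SimpleFunc Plane ℝ≥0∞ := fun n =>
    (SimpleFunc.eapprox (fun x => 1 - g x) n).restrict (B n)
  have hfval : ∀ n x, f n x = (B n).indicator (SimpleFunc.eapprox (fun x => 1 - g x) n) x :=
    fun n x => by simp only [f, SimpleFunc.restrict_apply _ (hB n)]
  have hfmono : ∀ x, Monotone fun n => f n x := by
    intro x n k hnk
    simp only [hfval]
    refine (Set.indicator_le_indicator_of_subset (Metric.ball_subset_ball (by exact_mod_cast hnk))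
      (fun _ => zero_le) x).trans (Set.indicator_le_indicator ?_)
    exact SimpleFunc.monotone_eapprox _ hnk x
  have hfsup : ∀ x, ⨆ n, f n x = 1 - g x := by
    intro x
    refine tendsto_nhds_unique (tendsto_atTop_iSup (hfmono x)) ?_
    have h1 : Tendsto (fun n => SimpleFunc.eapprox (fun x => 1 - g x) n x) atTop (𝓝 (1 - g x)) := by
      have := tendsto_atTop_iSup fun n k hnk =>
        (SimpleFunc.monotone_eapprox (fun x => 1 - g x) hnk x)
      rwa [SimpleFunc.iSup_eapprox_apply hfm] at this
    refine h1.congr' ?_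
    obtain ⟨N, hN⟩ := exists_nat_gt ‖x‖
    filter_upwards [eventually_ge_atTop N] with n hn
    rw [hfval, Set.indicator_of_mem]
    simp only [B, Metric.mem_ball, dist_zero_right]
    exact hN.trans_le (by exact_mod_cast hn)
  let gs : ℕ → SimpleFunc Plane ℝ≥0∞ := fun n => (f n).map fun y => 1 - y
  have hgs : ∀ n x, gs n x = 1 - f n x := fun n x => rfl
  have hgs1 : ∀ n x, gs n x ≤ 1 := fun n x => by rw [hgs]; exact tsub_le_self
  have hf1 : ∀ n x, f n x ≤ 1 := fun n x =>
    (le_iSup (fun n => f n x) n).trans ((hfsup x).le.trans tsub_le_self)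
  have hsimple := fun n => hX.lintegral_infProd_simpleFunc (gs n) (hgs1 n) (by
    intro c hc
    refine ne_top_of_le_ne_top (measure_ball_lt_top (μ := volume) (x := (0 : Plane)) (r := n)).ne
      (measure_mono ?_)
    intro x hx
    by_contra hxB
    have : f n x = 0 := by rw [hfval]; exact Set.indicator_of_notMem hxB _
    simp only [Set.mem_preimage, hgs, this, Set.mem_singleton_iff, tsub_zero] at hx
    exact hc hx.symm)
  have hanti : ∀ x, Antitone fun n => gs n x := fun x n k hnk => tsub_le_tsub_left (hfmono x hnk) 1
  have hginf : ∀ x, ⨅ n, gs n x = g x := by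
    intro x
    simp only [hgs]
    rw [← ENNReal.sub_iSup (by simp), hfsup, ENNReal.sub_sub_cancel (by simp) (hg x)]
  have hL : ∫⁻ ω, infProd (fun i => g (X i ω)) ∂P =
      ⨅ n, ∫⁻ ω, infProd (fun i => gs n (X i ω)) ∂P := by
    rw [← lintegral_iInf]
    · refine lintegral_congr fun ω => ?_
      rw [iInf_infProd (a := fun n i => gs n (X i ω)) (fun n i => hgs1 n _) fun i => hanti _]
      simp_rw [hginf]
    · exact fun n => measurable_infProd fun i => (gs n).measurable.comp (hX.measurable i)
    · intro n k hnk ω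
      exact infProd_mono fun i => hanti _ hnk
    · refine ne_top_of_le_ne_top ENNReal.one_ne_top
        ((lintegral_mono fun ω => infProd_le_one _).trans ?_)
      simp
  rw [hL]
  simp_rw [hsimple]
  have hss : ∀ n x, 1 - gs n x = f n x := fun n x => by
    rw [hgs, ENNReal.sub_sub_cancel (by simp) (hf1 n x)]
  simp_rw [hss]
  rw [iInf_expNeg, ← ENNReal.mul_iSup, ← lintegral_iSup (fun n => (f n).measurable)
    (fun n k hnk x => hfmono x hnk)]
  · simp_rw [hfsup]
  · intro n k hnk
    simp only
    gcongr with x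
    exact hfmono x hnk

end Laplace

/-! ### Point counts of a power-law Poisson process. -/

section PowerLaw

open Filter Topology

variable {Ω ι : Type*} [MeasurableSpace Ω] {P : Measure Ω}

/-- The random family `p`, up to nonpositive members, is a Poisson point process on `(0, ∞)` whose
intensity is the image of `c` times Lebesgue measure on `(0, ∞)` under `v ↦ v ^ (-γ)`. This is
expressed by its Laplace functional. -/
structure IsPowerLawPPP (p : ι → Ω → ℝ) (c γ : ℝ) (P : Measure Ω) : Prop where
  measurable : ∀ b, Measurable (p b)
  const_pos : 0 < c
  one_lt_exponent : 1 < γ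
  laplace : ∀ g : ℝ → ℝ≥0∞, Measurable g → (∀ x, g x ≤ 1) → g 0 = 1 →
    ∫⁻ ω, infProd (fun b => g (p b ω)) ∂P =
      expNeg (ENNReal.ofReal c * ∫⁻ v in Set.Ioi (0 : ℝ), 1 - g (v ^ (-γ)))

namespace IsPowerLawPPP

variable {p : ι → Ω → ℝ} {c γ : ℝ}

/-- The intensity measure of a set. -/
noncomputable def intensity (c γ : ℝ) (A : Set ℝ) : ℝ≥0∞ :=
  ENNReal.ofReal c * volume {v : ℝ | 0 < v ∧ v ^ (-γ) ∈ A}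

lemma measurable_count [Countable ι] (hp : IsPowerLawPPP p c γ P) {A : Set ℝ}
    (hA : MeasurableSet A) : Measurable fun ω => {b | p b ω ∈ A}.encard :=
  measurable_encard.comp (measurable_set_iff.2 fun b => measurable_mem.2 (hp.measurable b hA))

lemma lintegral_encardPow (hp : IsPowerLawPPP p c γ P) {A : Set ℝ} (hA : MeasurableSet A)
    (h0 : (0 : ℝ) ∉ A) {z : ℝ≥0∞} (hz : z ≤ 1) :
    ∫⁻ ω, encardPow z {b | p b ω ∈ A}.encard ∂P = expNeg ((1 - z) * intensity c γ A) := by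
  classical
  have h := hp.laplace (fun x => if x ∈ A then z else 1)
    (Measurable.ite hA measurable_const measurable_const)
    (fun x => by split_ifs <;> simp [hz]) (by simp [h0])
  have h1 : ∀ ω, encardPow z {b | p b ω ∈ A}.encard =
      infProd fun b => if p b ω ∈ A then z else 1 := fun ω =>
    (infProd_ite_mem {b | p b ω ∈ A} hz).symm
  simp_rw [h1]
  rw [h]
  congr 1
  have hm : MeasurableSet {v : ℝ | v ^ (-γ) ∈ A} :=
    (by fun_prop : Measurable fun v : ℝ => v ^ (-γ)) hA
  have h2 : ∀ v : ℝ, 1 - (if v ^ (-γ) ∈ A then z else 1) =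
      {v : ℝ | v ^ (-γ) ∈ A}.indicator (fun _ => 1 - z) v := by
    intro v
    by_cases hv : v ^ (-γ) ∈ A <;> simp [Set.indicator, hv]
  simp_rw [h2]
  rw [lintegral_indicator_const hm, Measure.restrict_apply hm, intensity, mul_left_comm]
  congr 3
  ext v; simp [and_comm]

/-- The generating function at `z = 0`, where `0 ^ 0 = 1` makes it the indicator of an empty count.
-/
lemma measure_count_eq_zero [Countable ι] (hp : IsPowerLawPPP p c γ P) {A : Set ℝ}
    (hA : MeasurableSet A) (h0 : (0 : ℝ) ∉ A) :
    P {ω | {b | p b ω ∈ A}.encard = 0} = expNeg (intensity c γ A) := by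
  have h := hp.lintegral_encardPow hA h0 (z := 0) zero_le
  rw [tsub_zero, one_mul] at h
  rw [← h, ← lintegral_indicator_one
    (show MeasurableSet {ω | {b | p b ω ∈ A}.encard = 0} from
      (hp.measurable_count hA) (measurableSet_singleton 0))]
  refine lintegral_congr fun ω => ?_
  simp only [Set.indicator, Set.mem_ofPred_eq, Pi.one_apply]
  generalize {b | p b ω ∈ A}.encard = n
  induction n using ENat.recTopCoe with
  | top => simp [encardPow]
  | coe n => rw [encardPow_natCast]; rcases n with _ | n <;> simp

variable [IsProbabilityMeasure P]

/-- For `z < 1` an infinite count contributes `z ^ ∞ = 0`, so the generating function is at most the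
probability of a finite count. It tends to 1 as `z` increases to 1 because the intensity is finite.
-/
lemma ae_count_lt_top [Countable ι] (hp : IsPowerLawPPP p c γ P) {A : Set ℝ}
    (hA : MeasurableSet A) (h0 : (0 : ℝ) ∉ A) (hfin : intensity c γ A ≠ ∞) :
    ∀ᵐ ω ∂P, {b | p b ω ∈ A}.Finite := by
  have hms : MeasurableSet {ω | {b | p b ω ∈ A}.encard ≠ ⊤} :=
    (hp.measurable_count hA) (.of_discrete (s := {x | x ≠ ⊤}))
  have hle : ∀ z < 1, expNeg ((1 - z) * intensity c γ A) ≤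
      P {ω | {b | p b ω ∈ A}.encard ≠ ⊤} := by
    intro z hz
    rw [← hp.lintegral_encardPow hA h0 hz.le, ← lintegral_indicator_one hms]
    refine lintegral_mono fun ω => ?_
    by_cases h : {b | p b ω ∈ A}.encard = ⊤
    · simp [h, encardPow, hz.ne]
    · simp only [encardPow, if_neg h]
      rw [Set.indicator_of_mem (show ω ∈ {ω | {b | p b ω ∈ A}.encard ≠ ⊤} from h)]
      exact pow_le_one' hz.le _
  have hlim : Tendsto (fun n : ℕ => expNeg ((1 - (1 - (n : ℝ≥0∞)⁻¹)) * intensity c γ A)) atTop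
      (𝓝 1) := by
    refine ((continuous_expNeg.tendsto' 0 1 expNeg_zero)).comp ?_
    have h1 : Tendsto (fun n : ℕ => (n : ℝ≥0∞)⁻¹ * intensity c γ A) atTop (𝓝 0) := by
      simpa using ENNReal.Tendsto.mul_const ENNReal.tendsto_inv_nat_nhds_zero (Or.inr hfin)
    refine h1.congr' ?_
    filter_upwards [eventually_ge_atTop 1] with n hn
    rw [ENNReal.sub_sub_cancel (by simp)]
    exact ENNReal.inv_le_one.2 (by exact_mod_cast hn)
  have h1 : 1 ≤ P {ω | {b | p b ω ∈ A}.encard ≠ ⊤} := by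
    refine le_of_tendsto hlim ?_
    filter_upwards [eventually_ge_atTop 1] with n hn
    refine hle _ (ENNReal.sub_lt_self (by simp) (by simp) ?_)
    simp
  have h2 := (prob_compl_eq_zero_iff hms).2 (le_antisymm prob_le_one h1)
  refine (ae_iff.2 ?_ : ∀ᵐ ω ∂P, {b | p b ω ∈ A}.encard ≠ ⊤).mono fun ω hω =>
    Set.encard_ne_top_iff.1 hω
  exact h2

lemma one_sub_sq_le_exp {m : ℝ} (hm : 0 ≤ m) : 1 - m ^ 2 ≤ Real.exp (-m) * (1 + m) := by
  nlinarith [Real.add_one_le_exp (-m)]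

/-- The probability of seeing two or more points is at most the square of the intensity. -/
lemma measure_two_le_count [Countable ι] (hp : IsPowerLawPPP p c γ P) {A : Set ℝ}
    (hA : MeasurableSet A) (h0 : (0 : ℝ) ∉ A) {m : ℝ} (hm : 0 ≤ m)
    (hA' : intensity c γ A = ENNReal.ofReal m) :
    P {ω | 2 ≤ {b | p b ω ∈ A}.encard} ≤ ENNReal.ofReal (m ^ 2) := by
  set N : Ω → ℕ∞ := fun ω => {b | p b ω ∈ A}.encard with hN
  have hNm : Measurable N := hp.measurable_count hA
  have hs : ∀ S : Set ℕ∞, MeasurableSet {ω | N ω ∈ S} := fun S => hNm .of_discrete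
  set q1 := P.real {ω | N ω ∈ ({1} : Set ℕ∞)} with hq1
  have hq0 : P.real {ω | N ω ∈ ({0} : Set ℕ∞)} = Real.exp (-m) := by
    have := hp.measure_count_eq_zero hA h0
    rw [hA', expNeg_ofReal hm] at this
    rw [measureReal_def, show P {ω | N ω ∈ ({0} : Set ℕ∞)} = _ from this,
      ENNReal.toReal_ofReal (Real.exp_pos _).le]
  -- Lower bound for the probability `q1` of exactly one point: compare the generating function
  -- exp(-m) exp(m z) ≥ exp(-m)(1 + m z) with its bound exp(-m) + z q1 + z², cancel exp(-m) and
  -- divide by `z`. Letting `z` tend to 0 afterwards gives exp(-m) m ≤ q1.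
  have key : ∀ z : ℝ, 0 < z → z ≤ 1 → Real.exp (-m) * m ≤ q1 + z := by
    intro z hz hz1
    have h := hp.lintegral_encardPow hA h0 (z := ENNReal.ofReal z) (by simpa using hz1)
    have e1 : (1 - ENNReal.ofReal z) * intensity c γ A = ENNReal.ofReal ((1 - z) * m) := by
      rw [hA', ENNReal.ofReal_mul (by linarith), ENNReal.ofReal_sub _ hz.le]; simp
    rw [e1, expNeg_ofReal (mul_nonneg (by linarith) hm)] at h
    have hub : ∫⁻ ω, encardPow (ENNReal.ofReal z) (N ω) ∂P ≤
        ∫⁻ ω, ({ω | N ω ∈ ({0} : Set ℕ∞)}.indicator 1 ω +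
          ({ω | N ω ∈ ({1} : Set ℕ∞)}.indicator (fun _ => ENNReal.ofReal z) ω +
            ENNReal.ofReal (z ^ 2))) ∂P := by
      refine lintegral_mono fun ω => ?_
      have hz2 : ENNReal.ofReal z ≤ 1 := by simpa using hz1
      generalize hn : N ω = n
      simp only [Set.indicator, Set.mem_ofPred_eq, hn, Set.mem_singleton_iff]
      induction n using ENat.recTopCoe with
      | top =>
        simp only [encardPow, if_true]
        split_ifs with h1 <;> simp_all
      | coe n =>
        rw [encardPow_natCast]
        match n with
        | 0 => simp
        | 1 => simp
        | n + 2 =>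
          have : ENNReal.ofReal z ^ (n + 2) ≤ ENNReal.ofReal (z ^ 2) := by
            rw [ENNReal.ofReal_pow hz.le]
            exact pow_le_pow_right_of_le_one' hz2 (by omega)
          exact this.trans (le_add_left (le_add_left le_rfl))
    rw [lintegral_add_left (measurable_one.indicator (hs _)), lintegral_add_right _ measurable_const,
      lintegral_indicator_one (hs _), lintegral_indicator_const (hs _), lintegral_const,
      measure_univ, mul_one, show ∫⁻ ω, encardPow (ENNReal.ofReal z) (N ω) ∂P = _ from h,
      ← ofReal_measureReal (s := {ω | N ω ∈ ({0} : Set ℕ∞)}),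
      ← ofReal_measureReal (s := {ω | N ω ∈ ({1} : Set ℕ∞)}), hq0, ← ENNReal.ofReal_mul hz.le,
      ← ENNReal.ofReal_add (by positivity) (by positivity),
      ← ENNReal.ofReal_add (by positivity) (by positivity),
      ENNReal.ofReal_le_ofReal_iff (by positivity)] at hub
    have h3 : Real.exp (-((1 - z) * m)) = Real.exp (-m) * Real.exp (m * z) := by
      rw [← Real.exp_add]; congr 1; ring
    have h4 := Real.add_one_le_exp (m * z)
    have h5 : Real.exp (-m) * (m * z) ≤ z * q1 + z ^ 2 := by
      nlinarith [Real.exp_pos (-m)]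
    refine le_of_mul_le_mul_left ?_ hz
    nlinarith
  have hq1m : Real.exp (-m) * m ≤ q1 := by
    refine le_of_forall_pos_le_add fun ε hε => ?_
    refine (key (min ε 1) (by positivity) (min_le_right _ _)).trans ?_
    gcongr
    exact min_le_left _ _
  have hunion : P.real {ω | 2 ≤ N ω} + (P.real {ω | N ω ∈ ({0} : Set ℕ∞)} + q1) ≤ 1 := by
    rw [hq1, ← measureReal_union _ (hs _), ← measureReal_union _ ((hs _).union (hs _))]
    · exact measureReal_le_one
    · rw [Set.disjoint_left]
      rintro ω h2 (h | h)
      · simp only [Set.mem_ofPred_eq, Set.mem_singleton_iff] at h h2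
        rw [h] at h2; simp at h2
      · simp only [Set.mem_ofPred_eq, Set.mem_singleton_iff] at h h2
        rw [h] at h2; exact absurd h2 (by decide)
    · rw [Set.disjoint_left]
      intro ω h h'
      simp only [Set.mem_ofPred_eq, Set.mem_singleton_iff] at h h'
      rw [h] at h'; simp at h'
  rw [← ofReal_measureReal]
  refine ENNReal.ofReal_le_ofReal ?_
  have := one_sub_sq_le_exp hm
  rw [hq0] at hunion
  change P.real {ω | 2 ≤ N ω} ≤ m ^ 2
  nlinarith

end IsPowerLawPPP

end PowerLaw

/-! ### Existence and uniqueness of the largest point. -/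

section PowerLaw

open Filter Topology

variable {Ω ι : Type*} [MeasurableSpace Ω] {P : Measure Ω}

namespace IsPowerLawPPP

variable {p : ι → Ω → ℝ} {c γ : ℝ}

lemma exponent_pos (hp : IsPowerLawPPP p c γ P) : 0 < γ := one_pos.trans hp.one_lt_exponent

lemma rpow_neg_inv_rpow_neg {γ x : ℝ} (hγ : γ ≠ 0) (hx : 0 ≤ x) :
    (x ^ (-γ)) ^ (-γ⁻¹) = x := by
  rw [← Real.rpow_mul hx, neg_mul_neg, mul_inv_cancel₀ hγ, Real.rpow_one]

lemma lt_rpow_neg_iff {γ t v : ℝ} (hγ : 0 < γ) (ht : 0 < t) (hv : 0 < v) :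
    t < v ^ (-γ) ↔ v < t ^ (-γ⁻¹) := by
  rw [← Real.rpow_lt_rpow_iff_of_neg (Real.rpow_pos_of_pos hv _) ht
    (neg_lt_zero.2 (inv_pos.2 hγ)), rpow_neg_inv_rpow_neg hγ.ne' hv.le]

lemma intensity_Ioi {t : ℝ} (hγ : 0 < γ) (ht : 0 < t) :
    intensity c γ (Set.Ioi t) = ENNReal.ofReal c * ENNReal.ofReal (t ^ (-γ⁻¹)) := by
  have : {v : ℝ | 0 < v ∧ v ^ (-γ) ∈ Set.Ioi t} = Set.Ioo 0 (t ^ (-γ⁻¹)) := by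
    ext v
    simp only [Set.mem_ofPred_eq, Set.mem_Ioi, Set.mem_Ioo]
    exact and_congr_right fun hv => lt_rpow_neg_iff hγ ht hv
  rw [intensity, this, Real.volume_Ioo, sub_zero]

variable [Countable ι]

/-- If no point is positive, none exceeds (n+1)^(-γ). That has probability exp(-c (n+1)), which
tends to 0. -/
lemma ae_exists_pos (hp : IsPowerLawPPP p c γ P) : ∀ᵐ ω ∂P, ∃ b, 0 < p b ω := by
  rw [ae_iff]
  have hγ := hp.exponent_pos
  have hle : ∀ n : ℕ, P {ω | ¬ ∃ b, 0 < p b ω} ≤ expNeg (ENNReal.ofReal c * n) := by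
    intro n
    have hs : (0 : ℝ) < n + 1 := by positivity
    have ht : 0 < ((n : ℝ) + 1) ^ (-γ) := Real.rpow_pos_of_pos hs _
    have h := hp.measure_count_eq_zero (A := Set.Ioi (((n : ℝ) + 1) ^ (-γ))) measurableSet_Ioi
      (by simpa using ht.le)
    rw [intensity_Ioi hγ ht, rpow_neg_inv_rpow_neg hγ.ne' hs.le] at h
    refine (measure_mono ?_).trans (h.le.trans (expNeg_antitone ?_))
    · intro ω hω
      simp only [Set.mem_ofPred_eq, not_exists, not_lt] at hω
      simp only [Set.mem_ofPred_eq, Set.encard_eq_zero, Set.mem_Ioi]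
      ext b
      simpa using (hω b).trans ht.le
    · gcongr
      rw [← ENNReal.ofReal_natCast]
      exact ENNReal.ofReal_le_ofReal (by linarith)
  have hlim : Tendsto (fun n : ℕ => expNeg (ENNReal.ofReal c * n)) atTop (𝓝 0) := by
    refine (continuous_expNeg.tendsto' ∞ 0 (by simp [expNeg])).comp ?_
    have hc : ENNReal.ofReal c ≠ 0 := by simpa using hp.const_pos
    have := ENNReal.Tendsto.const_mul (a := ENNReal.ofReal c) ENNReal.tendsto_nat_nhds_top
      (Or.inl (by simp))
    rwa [ENNReal.mul_top hc] at this
  exact le_antisymm (ge_of_tendsto hlim (Eventually.of_forall hle)) zero_le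

variable [IsProbabilityMeasure P]

lemma ae_finite_gt (hp : IsPowerLawPPP p c γ P) :
    ∀ᵐ ω ∂P, ∀ t > 0, {b | t < p b ω}.Finite := by
  have h : ∀ n : ℕ, ∀ᵐ ω ∂P, {b | p b ω ∈ Set.Ioi (1 / ((n : ℝ) + 1))}.Finite := by
    intro n
    have hn : 0 < 1 / ((n : ℝ) + 1) := by positivity
    refine hp.ae_count_lt_top measurableSet_Ioi (by simpa using hn.le) ?_
    rw [intensity_Ioi hp.exponent_pos hn]
    exact ENNReal.mul_ne_top ENNReal.ofReal_ne_top ENNReal.ofReal_ne_top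
  filter_upwards [ae_all_iff.2 h] with ω hω t ht
  obtain ⟨n, hn⟩ := exists_nat_one_div_lt ht
  exact (hω n).subset fun b hb => hn.trans hb

/-- In the coordinate v = p^(-1/γ) the intensity is `c` times length. A tie with v < T puts two
indices in one cell of length 1/(n+1). There are (n+1) T cells, each with probability at most
(c/(n+1))² of this, so the total is at most T c²/(n+1), for every n. -/
lemma ae_injOn_pos (hp : IsPowerLawPPP p c γ P) :
    ∀ᵐ ω ∂P, ∀ b b', b ≠ b' → p b ω = p b' ω → p b ω ≤ 0 := by
  have hγ := hp.exponent_pos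
  have hc := hp.const_pos
  have key : ∀ T : ℕ, P {ω | ∃ b b', b ≠ b' ∧ p b ω = p b' ω ∧ 0 < p b ω ∧
      (p b ω) ^ (-γ⁻¹) < T} = 0 := by
    intro T
    set S := {ω | ∃ b b', b ≠ b' ∧ p b ω = p b' ω ∧ 0 < p b ω ∧ (p b ω) ^ (-γ⁻¹) < T} with hS
    let A : ℕ → ℕ → Set ℝ := fun n j =>
      {x | 0 < x ∧ x ^ (-γ⁻¹) ∈ Set.Ico ((j : ℝ) / (n + 1)) ((j + 1 : ℝ) / (n + 1))}
    have hA : ∀ n j, MeasurableSet (A n j) := fun n j =>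
      measurableSet_Ioi.inter
        ((by fun_prop : Measurable fun x : ℝ => x ^ (-γ⁻¹)) measurableSet_Ico)
    have hA0 : ∀ n j, (0 : ℝ) ∉ A n j := fun n j h => lt_irrefl _ h.1
    have hAi : ∀ n j, intensity c γ (A n j) ≤ ENNReal.ofReal (c / (n + 1)) := by
      intro n j
      rw [intensity, div_eq_mul_one_div c, ENNReal.ofReal_mul hc.le]
      gcongr
      have hsub : {v : ℝ | 0 < v ∧ v ^ (-γ) ∈ A n j} ⊆
          Set.Ico ((j : ℝ) / (n + 1)) ((j + 1 : ℝ) / (n + 1)) := by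
        rintro v ⟨hv, hv'⟩
        simpa only [rpow_neg_inv_rpow_neg hγ.ne' hv.le] using hv'.2
      refine (measure_mono hsub).trans ?_
      rw [Real.volume_Ico]
      refine ENNReal.ofReal_le_ofReal (le_of_eq ?_)
      ring
    have hAm : ∀ n j, P {ω | 2 ≤ {b | p b ω ∈ A n j}.encard} ≤
        ENNReal.ofReal ((c / (n + 1)) ^ 2) := by
      intro n j
      have hne : intensity c γ (A n j) ≠ ∞ := ne_top_of_le_ne_top (by simp) (hAi n j)
      refine (hp.measure_two_le_count (hA n j) (hA0 n j) ENNReal.toReal_nonneg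
        (ENNReal.ofReal_toReal hne).symm).trans (ENNReal.ofReal_le_ofReal ?_)
      gcongr
      exact ENNReal.toReal_le_of_le_ofReal (by positivity) (hAi n j)
    have hcover : ∀ n : ℕ, S ⊆ ⋃ j ∈ Finset.range ((n + 1) * T),
        {ω | 2 ≤ {b | p b ω ∈ A n j}.encard} := by
      rintro n ω ⟨b, b', hbb, heq, hpos, hT⟩
      have hn : (0 : ℝ) < n + 1 := by positivity
      set v := (p b ω) ^ (-γ⁻¹) with hv
      have hv0 : 0 ≤ v := Real.rpow_nonneg hpos.le _
      have hfl : (⌊(n + 1 : ℝ) * v⌋₊ : ℝ) ≤ (n + 1) * v := Nat.floor_le (by positivity)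
      have hfl' : (n + 1 : ℝ) * v < ⌊(n + 1 : ℝ) * v⌋₊ + 1 := Nat.lt_floor_add_one _
      have hmem : p b ω ∈ A n ⌊(n + 1 : ℝ) * v⌋₊ := by
        refine ⟨hpos, ?_, ?_⟩
        · rw [div_le_iff₀ hn]; linarith
        · rw [lt_div_iff₀ hn]; linarith
      simp only [Set.mem_iUnion, Finset.mem_range, exists_prop]
      refine ⟨⌊(n + 1 : ℝ) * v⌋₊, ?_, ?_⟩
      · have : (⌊(n + 1 : ℝ) * v⌋₊ : ℝ) < ((n + 1) * T : ℕ) := by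
          push_cast
          exact hfl.trans_lt (by gcongr)
        exact_mod_cast this
      · simp only [Set.mem_ofPred_eq]
        rw [← Set.encard_pair hbb]
        refine Set.encard_le_encard ?_
        rintro x (rfl | rfl)
        · exact hmem
        · simpa only [Set.mem_ofPred_eq, ← heq] using hmem
    have hbound : ∀ n : ℕ, P S ≤ ENNReal.ofReal (T * c ^ 2 / (n + 1)) := by
      intro n
      refine (measure_mono (hcover n)).trans ((measure_biUnion_finset_le _ _).trans
        ((Finset.sum_le_sum fun j _ => hAm n j).trans ?_))
      rw [Finset.sum_const, Finset.card_range, nsmul_eq_mul, ← ENNReal.ofReal_natCast,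
        ← ENNReal.ofReal_mul (by positivity)]
      refine ENNReal.ofReal_le_ofReal (le_of_eq ?_)
      have : (n : ℝ) + 1 ≠ 0 := by positivity
      push_cast
      field_simp
    have hlim : Tendsto (fun n : ℕ => ENNReal.ofReal (T * c ^ 2 / (n + 1))) atTop (𝓝 0) := by
      rw [← ENNReal.ofReal_zero]
      refine (ENNReal.continuous_ofReal.tendsto 0).comp ?_
      have := (tendsto_one_div_add_atTop_nhds_zero_nat (𝕜 := ℝ)).const_mul (T * c ^ 2)
      simpa [div_eq_mul_inv] using this
    exact le_antisymm (ge_of_tendsto hlim (Eventually.of_forall hbound)) zero_le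
  have key' : ∀ᵐ ω ∂P, ∀ T : ℕ, ¬ ∃ b b', b ≠ b' ∧ p b ω = p b' ω ∧ 0 < p b ω ∧
      (p b ω) ^ (-γ⁻¹) < T := by
    rw [ae_all_iff]
    intro T
    rw [ae_iff]
    simpa only [not_not] using key T
  filter_upwards [key'] with ω hω b b' hbb heq
  by_contra! hpos
  obtain ⟨T, hT⟩ := exists_nat_gt ((p b ω) ^ (-γ⁻¹))
  exact hω T ⟨b, b', hbb, heq, hpos, hT⟩

/-- Almost surely there is a unique largest point. -/
theorem ae_exists_strict_argmax (hp : IsPowerLawPPP p c γ P) :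
    ∀ᵐ ω ∂P, ∃ b, 0 < p b ω ∧ ∀ l, l ≠ b → p l ω < p b ω := by
  filter_upwards [hp.ae_finite_gt, hp.ae_exists_pos, hp.ae_injOn_pos] with ω hfin ⟨b₀, hb₀⟩ hinj
  -- Half the value at a positive point is a positive level, so finitely many points exceed it, and
  -- `b₀` is among them.
  obtain ⟨b, hb, hmax⟩ := (hfin (p b₀ ω / 2) (by positivity)).exists_maximalFor (fun b => p b ω) _
    ⟨b₀, by simpa using half_lt_self hb₀⟩
  have hb' : p b₀ ω / 2 < p b ω := hb
  have hpos : 0 < p b ω := by linarith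
  refine ⟨b, hpos, fun l hl => ?_⟩
  have hle : p l ω ≤ p b ω := by
    by_contra! h
    exact absurd (hmax (show p b₀ ω / 2 < p l ω from hb'.trans h) h.le) (not_le.2 h)
  refine lt_of_le_of_ne hle fun h => ?_
  exact absurd (hinj b l hl.symm h.symm) (not_le.2 hpos)

end IsPowerLawPPP

end PowerLaw

/-! ### The function H(a) and the truncated factors. -/

section Tail

open Filter Topology

/-- The function `a + ∫_a^∞ β / (w ^ γ + β) dw`. -/
noncomputable def tailIntegral (β γ a : ℝ) : ℝ := a + ∫ w in Set.Ioi a, β / (w ^ γ + β)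

variable {β γ a b u : ℝ}

lemma integrableOn_div_rpow_add (hβ : 0 < β) (hγ : 1 < γ) (ha : 0 < a) :
    IntegrableOn (fun w : ℝ => β / (w ^ γ + β)) (Set.Ioi a) := by
  refine Integrable.mono' ((integrableOn_Ioi_rpow_of_lt (neg_lt_neg hγ) ha).const_mul β)
    (by fun_prop : Measurable fun w : ℝ => β / (w ^ γ + β)).aestronglyMeasurable ?_
  refine (ae_restrict_mem measurableSet_Ioi).mono fun w hw => ?_
  have hw0 : 0 < w := ha.trans hw
  have hp := Real.rpow_pos_of_pos hw0 γ
  rw [Real.norm_of_nonneg (by positivity), Real.rpow_neg hw0.le, ← div_eq_mul_inv]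
  gcongr
  linarith

lemma setIntegral_div_rpow_add_nonneg (hβ : 0 < β) (ha : 0 < a) :
    0 ≤ ∫ w in Set.Ioi a, β / (w ^ γ + β) := by
  refine setIntegral_nonneg measurableSet_Ioi fun w hw => ?_
  have := Real.rpow_pos_of_pos (ha.trans hw) γ
  positivity

lemma tailIntegral_pos (hβ : 0 < β) (ha : 0 < a) : 0 < tailIntegral β γ a :=
  add_pos_of_pos_of_nonneg ha (setIntegral_div_rpow_add_nonneg hβ ha)

lemma tailIntegral_sub (hβ : 0 < β) (hγ : 1 < γ) (ha : 0 < a) (hab : a ≤ b) :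
    tailIntegral β γ b - tailIntegral β γ a = (b - a) - ∫ w in a..b, β / (w ^ γ + β) := by
  have h := intervalIntegral.integral_interval_add_Ioi (integrableOn_div_rpow_add hβ hγ ha)
    (integrableOn_div_rpow_add hβ hγ (ha.trans_le hab))
  unfold tailIntegral
  rw [← h]; ring

lemma intervalIntegrable_div_rpow_add (hβ : 0 < β) (hγ : 1 < γ) (ha : 0 < a) (hab : a ≤ b) :
    IntervalIntegrable (fun w : ℝ => β / (w ^ γ + β)) volume a b := by
  rw [intervalIntegrable_iff_integrableOn_Ioc_of_le hab]
  exact (integrableOn_div_rpow_add hβ hγ ha).mono_set Set.Ioc_subset_Ioi_self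

/-- The derivative w^γ/(w^γ + β) of H is increasing, so its value at the left endpoint bounds the
difference quotient from below; in `tailIntegral_sub_le` the right endpoint bounds it from above.
These bounds replace differentiation of H at 1. -/
lemma le_tailIntegral_sub (hβ : 0 < β) (hγ : 1 < γ) (ha : 0 < a) (hab : a ≤ b) :
    (b - a) * (a ^ γ / (a ^ γ + β)) ≤ tailIntegral β γ b - tailIntegral β γ a := by
  rw [tailIntegral_sub hβ hγ ha hab]
  have hp := Real.rpow_pos_of_pos ha γ
  have h : ∫ w in a..b, β / (w ^ γ + β) ≤ ∫ _ in a..b, β / (a ^ γ + β) := by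
    refine intervalIntegral.integral_mono_on hab (intervalIntegrable_div_rpow_add hβ hγ ha hab)
      (by simp) fun w hw => ?_
    have := Real.rpow_le_rpow ha.le hw.1 (by linarith : 0 ≤ γ)
    gcongr
  rw [intervalIntegral.integral_const, smul_eq_mul] at h
  have e : a ^ γ / (a ^ γ + β) = 1 - β / (a ^ γ + β) := by field_simp; ring
  rw [e]; linarith

lemma tailIntegral_sub_le (hβ : 0 < β) (hγ : 1 < γ) (ha : 0 < a) (hab : a ≤ b) :
    tailIntegral β γ b - tailIntegral β γ a ≤ (b - a) * (b ^ γ / (b ^ γ + β)) := by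
  rw [tailIntegral_sub hβ hγ ha hab]
  have hp := Real.rpow_pos_of_pos (ha.trans_le hab) γ
  have h : ∫ _ in a..b, β / (b ^ γ + β) ≤ ∫ w in a..b, β / (w ^ γ + β) := by
    refine intervalIntegral.integral_mono_on hab (by simp)
      (intervalIntegrable_div_rpow_add hβ hγ ha hab) fun w hw => ?_
    have h0 := ha.trans_le hw.1
    have := Real.rpow_le_rpow h0.le hw.2 (by linarith : 0 ≤ γ)
    have := Real.rpow_pos_of_pos h0 γ
    gcongr
  rw [intervalIntegral.integral_const, smul_eq_mul] at h
  have e : b ^ γ / (b ^ γ + β) = 1 - β / (b ^ γ + β) := by field_simp; ring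
  rw [e]; linarith

lemma tailIntegral_mono (hβ : 0 < β) (hγ : 1 < γ) (ha : 0 < a) (hab : a ≤ b) :
    tailIntegral β γ a ≤ tailIntegral β γ b := by
  have h := le_tailIntegral_sub hβ hγ ha hab
  have hp := Real.rpow_pos_of_pos ha γ
  have : 0 ≤ (b - a) * (a ^ γ / (a ^ γ + β)) := mul_nonneg (by linarith) (by positivity)
  linarith

/-- The Laplace transform at `x ∈ [0, ∞)` of a standard exponential variable, as a factor of an
infinite product. -/
noncomputable def expFactor (x : ℝ) : ℝ≥0∞ := (1 + ENNReal.ofReal x)⁻¹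

lemma expFactor_le_one (x : ℝ) : expFactor x ≤ 1 := by
  unfold expFactor; rw [ENNReal.inv_le_one]; exact le_self_add

lemma expFactor_zero : expFactor 0 = 1 := by simp [expFactor]

lemma measurable_expFactor : Measurable expFactor := by unfold expFactor; fun_prop

lemma expFactor_antitone : Antitone expFactor := by
  intro x y h; unfold expFactor; gcongr

lemma expFactor_of_nonneg {x : ℝ} (hx : 0 ≤ x) : expFactor x = ENNReal.ofReal (1 / (1 + x)) := by
  rw [expFactor, one_div, ENNReal.ofReal_inv_of_pos (by linarith), ENNReal.ofReal_add one_pos.le hx,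
    ENNReal.ofReal_one]

lemma one_sub_expFactor {x : ℝ} (hx : 0 ≤ x) :
    1 - expFactor x = ENNReal.ofReal (x / (1 + x)) := by
  rw [expFactor_of_nonneg hx, ← ENNReal.ofReal_one, ← ENNReal.ofReal_sub _ (by positivity)]
  congr 1; field_simp; ring

lemma setIntegral_Ioi_scale (hu : 0 < u) :
    ∫ v in Set.Ioi (a * u), β / ((v / u) ^ γ + β) = u * ∫ w in Set.Ioi a, β / (w ^ γ + β) := by
  have h := integral_comp_mul_left_Ioi (fun w : ℝ => β / (w ^ γ + β)) (a * u) (inv_pos.2 hu)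
  rw [inv_inv, smul_eq_mul, show u⁻¹ * (a * u) = a by field_simp] at h
  rw [← h]
  simp_rw [div_eq_inv_mul _ u]

lemma integrableOn_Ioi_scale (hβ : 0 < β) (hγ : 1 < γ) (ha : 0 < a) (hu : 0 < u) :
    IntegrableOn (fun v => β / ((v / u) ^ γ + β)) (Set.Ioi (a * u)) := by
  have h := (integrableOn_Ioi_comp_mul_left_iff (fun w : ℝ => β / (w ^ γ + β)) (a * u)
    (inv_pos.2 hu)).2 (by
      rw [show u⁻¹ * (a * u) = a by field_simp]; exact integrableOn_div_rpow_add hβ hγ ha)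
  simpa only [div_eq_inv_mul _ u] using h

/-- Truncated interference factor: all points must be at most `(a * u) ^ (-γ)`. -/
noncomputable def truncFactor (β γ a u x : ℝ) : ℝ≥0∞ :=
  if x ≤ (a * u) ^ (-γ) then expFactor (β * u ^ γ * x) else 0

lemma truncFactor_le_one (β γ a u x : ℝ) : truncFactor β γ a u x ≤ 1 := by
  unfold truncFactor; split_ifs
  · exact expFactor_le_one _
  · simp

lemma measurable_truncFactor {α : Type*} [MeasurableSpace α] {f g : α → ℝ} (hf : Measurable f)
    (hg : Measurable g) : Measurable fun x => truncFactor β γ a (f x) (g x) := by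
  unfold truncFactor
  refine Measurable.ite (measurableSet_le hg (by fun_prop)) (measurable_expFactor.comp ?_)
    measurable_const
  fun_prop

/-- Points with v < a u are forbidden and contribute the length a u. Beyond that, v = u w scales u
out of the interference integral, so the whole exponent is linear in u. -/
lemma lintegral_one_sub_truncFactor (hβ : 0 < β) (hγ : 1 < γ) (ha : 0 < a) (hu : 0 < u) :
    ∫⁻ v in Set.Ioi (0 : ℝ), 1 - truncFactor β γ a u (v ^ (-γ)) =
      ENNReal.ofReal (u * tailIntegral β γ a) := by
  have hau : 0 < a * u := mul_pos ha hu
  have hγ0 : 0 < γ := by linarith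
  have hsplit : Set.Ioi (0 : ℝ) = Set.Ioc 0 (a * u) ∪ Set.Ioi (a * u) :=
    (Set.Ioc_union_Ioi_eq_Ioi hau.le).symm
  rw [hsplit, lintegral_union measurableSet_Ioi (Set.Ioc_disjoint_Ioi le_rfl)]
  have h1 : ∫⁻ v in Set.Ioc 0 (a * u), 1 - truncFactor β γ a u (v ^ (-γ)) =
      ENNReal.ofReal (a * u) := by
    -- At the endpoint v = a u the truncation is not violated, hence the passage to the open
    -- interval.
    rw [← setLIntegral_congr (Ioo_ae_eq_Ioc (a := (0 : ℝ)) (b := a * u)),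
      setLIntegral_congr_fun (g := fun _ => 1) measurableSet_Ioo]
    · simp
    · intro v hv
      have : ¬ v ^ (-γ) ≤ (a * u) ^ (-γ) := by
        rw [not_le]
        exact Real.rpow_lt_rpow_of_neg hv.1 hv.2 (by linarith)
      simp [truncFactor, this]
  have h2 : ∫⁻ v in Set.Ioi (a * u), 1 - truncFactor β γ a u (v ^ (-γ)) =
      ENNReal.ofReal (u * ∫ w in Set.Ioi a, β / (w ^ γ + β)) := by
    rw [← setIntegral_Ioi_scale hu, ofReal_integral_eq_lintegral_ofReal
      (integrableOn_Ioi_scale hβ hγ ha hu)]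
    · refine setLIntegral_congr_fun measurableSet_Ioi fun v hv => ?_
      have hv0 : 0 < v := hau.trans hv
      have hle : v ^ (-γ) ≤ (a * u) ^ (-γ) :=
        Real.rpow_le_rpow_of_nonpos hau (le_of_lt hv) (by linarith)
      have hpu := Real.rpow_pos_of_pos hu γ
      have hpv := Real.rpow_pos_of_pos hv0 γ
      simp only [truncFactor, if_pos hle]
      rw [one_sub_expFactor (by positivity), Real.rpow_neg hv0.le, Real.div_rpow hv0.le hu.le]
      congr 1
      field_simp
    · refine (ae_restrict_mem measurableSet_Ioi).mono fun v hv => ?_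
      have := Real.rpow_pos_of_pos (div_pos (hau.trans hv) hu) γ
      simp only [Pi.zero_apply]
      positivity
  rw [h1, h2, ← ENNReal.ofReal_add hau.le
    (mul_nonneg hu.le (setIntegral_div_rpow_add_nonneg hβ ha)), tailIntegral]
  congr 1; ring

lemma lintegral_Ioi_exp_neg_mul {k : ℝ} (hk : 0 < k) :
    ∫⁻ u in Set.Ioi (0 : ℝ), ENNReal.ofReal (Real.exp (-(k * u))) = ENNReal.ofReal (1 / k) := by
  have hi := integrableOn_exp_mul_Ioi (neg_lt_zero.2 hk) 0
  have h := integral_exp_mul_Ioi (neg_lt_zero.2 hk) 0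
  simp only [neg_mul] at hi h
  rw [← ofReal_integral_eq_lintegral_ofReal hi (ae_of_all _ fun u => (Real.exp_pos _).le), h]
  simp

end Tail

/-! ### The product of interference factors normalised by the largest point. -/

section PowerLaw

open Filter Topology

variable {Ω ι : Type*} [MeasurableSpace Ω] {P : Measure Ω}

namespace IsPowerLawPPP

variable {p : ι → Ω → ℝ} {c γ β a b u : ℝ}

lemma lintegral_truncFactor (hp : IsPowerLawPPP p c γ P) (hβ : 0 < β) (ha : 0 < a) (hu : 0 < u) :
    ∫⁻ ω, infProd (fun l => truncFactor β γ a u (p l ω)) ∂P =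
      ENNReal.ofReal (Real.exp (-(c * tailIntegral β γ a * u))) := by
  rw [hp.laplace (truncFactor β γ a u) (measurable_truncFactor measurable_const measurable_id)
    (truncFactor_le_one β γ a u)]
  · rw [lintegral_one_sub_truncFactor hβ hp.one_lt_exponent ha hu,
      ← ENNReal.ofReal_mul hp.const_pos.le, expNeg_ofReal]
    · congr 3; ring
    · have := tailIntegral_pos (γ := γ) hβ ha
      have := hp.const_pos
      positivity
  · have := Real.rpow_nonneg (mul_pos ha hu).le (-γ)
    simp [truncFactor, this, expFactor_zero]

lemma rpow_neg_inv_rpow (hγ : 0 < γ) {x : ℝ} (hx : 0 < x) : (x ^ (-γ⁻¹)) ^ γ = x⁻¹ := by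
  rw [← Real.rpow_mul hx.le, neg_mul, inv_mul_cancel₀ hγ.ne', Real.rpow_neg_one]

lemma expFactor_of_nonpos {x : ℝ} (hx : x ≤ 0) : expFactor x = 1 := by
  simp [expFactor, ENNReal.ofReal_of_nonpos hx]

lemma expFactor_mul_mono (hβ : 0 ≤ β) {r s : ℝ} (hr : 0 ≤ r) (hrs : r ≤ s) (q : ℝ) :
    expFactor (β * s * q) ≤ expFactor (β * r * q) := by
  rcases le_total q 0 with hq | hq
  · rw [expFactor_of_nonpos (x := β * r * q)
      (mul_nonpos_of_nonneg_of_nonpos (mul_nonneg hβ hr) hq)]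
    exact expFactor_le_one _
  · apply expFactor_antitone; gcongr

/-- The infinite product of truncated factors, at a configuration with strict maximum at `i`. -/
lemma infProd_truncFactor_eq {q : ι → ℝ} {i : ι} (hγ : 0 < γ) (hi : 0 < q i)
    (hmax : ∀ l, l ≠ i → q l < q i) (ha : 0 < a) (hu : 0 < u) :
    infProd (fun l => truncFactor β γ a u (q l)) =
      if a * u ≤ (q i) ^ (-γ⁻¹) then infProd (fun l => expFactor (β * u ^ γ * q l)) else 0 := by
  have hau := mul_pos ha hu
  have hiff : q i ≤ (a * u) ^ (-γ) ↔ a * u ≤ (q i) ^ (-γ⁻¹) := by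
    rw [← Real.rpow_le_rpow_iff_of_neg (Real.rpow_pos_of_pos hau _) hi
      (neg_lt_zero.2 (inv_pos.2 hγ)), rpow_neg_inv_rpow_neg hγ.ne' hau.le]
  split_ifs with h
  · congr 1; ext l
    have hle : q l ≤ q i := by
      rcases eq_or_ne l i with rfl | hl
      · exact le_rfl
      · exact (hmax l hl).le
    rw [truncFactor, if_pos (hle.trans (hiff.2 h))]
  · refine infProd_eq_zero (i := i) ?_
    rw [truncFactor, if_neg fun h' => h (hiff.1 h')]

/-- The truncation only tests the largest point, so the two products agree unless a u ≤ m < b u with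
m = (q i)^(-1/γ). This localises u near m when a and b are near 1. -/
lemma infProd_truncFactor_sub_eq {q : ι → ℝ} {i : ι} (hγ : 0 < γ) (hi : 0 < q i)
    (hmax : ∀ l, l ≠ i → q l < q i) (ha : 0 < a) (hab : a ≤ b) (hu : 0 < u) :
    infProd (fun l => truncFactor β γ a u (q l)) - infProd (fun l => truncFactor β γ b u (q l)) =
      if (q i) ^ (-γ⁻¹) / b < u ∧ u ≤ (q i) ^ (-γ⁻¹) / a then
        infProd (fun l => expFactor (β * u ^ γ * q l)) else 0 := by
  have hb := ha.trans_le hab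
  rw [infProd_truncFactor_eq hγ hi hmax ha hu, infProd_truncFactor_eq hγ hi hmax hb hu]
  simp only [div_lt_iff₀' hb, le_div_iff₀' ha]
  have hle : a * u ≤ b * u := by gcongr
  by_cases h1 : a * u ≤ q i ^ (-γ⁻¹)
  · by_cases h2 : b * u ≤ q i ^ (-γ⁻¹)
    · simp [h1, h2, h2.not_gt]
    · simp [h1, h2, not_le.1 h2]
  · have h2 : ¬ b * u ≤ q i ^ (-γ⁻¹) := fun h => h1 (hle.trans h)
    simp [h1, h2]

lemma infProd_truncFactor_antitone (ha : 0 < a) (hab : a ≤ b) (hu : 0 < u) (hγ : 0 < γ)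
    (q : ι → ℝ) :
    infProd (fun l => truncFactor β γ b u (q l)) ≤ infProd (fun l => truncFactor β γ a u (q l)) := by
  refine infProd_mono fun l => ?_
  have h : (b * u) ^ (-γ) ≤ (a * u) ^ (-γ) :=
    Real.rpow_le_rpow_of_nonpos (mul_pos ha hu) (by gcongr) (by linarith)
  unfold truncFactor
  split_ifs with h1 h2
  · exact le_rfl
  · exact absurd (h1.trans h) h2
  · exact zero_le
  · exact le_rfl

variable [Countable ι]

lemma measurable_infProd_truncFactor (hp : IsPowerLawPPP p c γ P) :
    Measurable fun x : Ω × ℝ => infProd fun l => truncFactor β γ a x.2 (p l x.1) :=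
  measurable_infProd fun l =>
    measurable_truncFactor measurable_snd ((hp.measurable l).comp measurable_fst)

variable [IsProbabilityMeasure P]

/-- Tonelli: for fixed u the expectation is a difference of two explicit exponentials, while for
fixed ω the u-integral runs over a window around m. -/
lemma lintegral_lintegral_sub (hp : IsPowerLawPPP p c γ P) (hβ : 0 < β) (ha : 0 < a)
    (hab : a ≤ b) :
    ∫⁻ ω, (∫⁻ u in Set.Ioi (0 : ℝ), (infProd (fun l => truncFactor β γ a u (p l ω)) -
        infProd (fun l => truncFactor β γ b u (p l ω))) * ENNReal.ofReal (1 / u)) ∂P =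
      ∫⁻ u in Set.Ioi (0 : ℝ), ENNReal.ofReal ((Real.exp (-(c * tailIntegral β γ a * u)) -
        Real.exp (-(c * tailIntegral β γ b * u))) / u) := by
  have hma := hp.measurable_infProd_truncFactor (β := β) (a := a)
  have hmb := hp.measurable_infProd_truncFactor (β := β) (a := b)
  rw [lintegral_lintegral_swap]
  · refine setLIntegral_congr_fun measurableSet_Ioi fun u hu => ?_
    have hu : 0 < u := hu
    have hmb' := hmb.comp (measurable_prodMk_right (y := u))
    simp only [Function.comp_def] at hmb'
    rw [lintegral_mul_const' _ _ (by simp), lintegral_sub hmb',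
      hp.lintegral_truncFactor hβ ha hu, hp.lintegral_truncFactor hβ (ha.trans_le hab) hu,
      ← ENNReal.ofReal_sub _ (Real.exp_pos _).le, ← ENNReal.ofReal_mul', mul_one_div]
    · positivity
    · rw [hp.lintegral_truncFactor hβ (ha.trans_le hab) hu]; simp
    · exact ae_of_all _ fun ω => infProd_truncFactor_antitone ha hab hu hp.exponent_pos _
  · refine Measurable.aemeasurable ?_
    exact (hma.sub hmb).mul (by fun_prop)

/-- The integral is Frullani's, with value log(h₂/h₁). Bounding the difference of exponentials by a
tangent line suffices, and here as in `le_lintegral_exp_sub` the constant `c` cancels. -/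
lemma lintegral_exp_sub_le (hc : 0 < c) {h₁ h₂ : ℝ} (h1 : 0 < h₁) (h12 : h₁ ≤ h₂) :
    ∫⁻ u in Set.Ioi (0 : ℝ), ENNReal.ofReal ((Real.exp (-(c * h₁ * u)) -
      Real.exp (-(c * h₂ * u))) / u) ≤ ENNReal.ofReal ((h₂ - h₁) / h₁) := by
  have e : ENNReal.ofReal ((h₂ - h₁) / h₁) = ENNReal.ofReal (c * (h₂ - h₁)) *
      ∫⁻ u in Set.Ioi (0 : ℝ), ENNReal.ofReal (Real.exp (-(c * h₁ * u))) := by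
    rw [lintegral_Ioi_exp_neg_mul (mul_pos hc h1), ← ENNReal.ofReal_mul
      (mul_nonneg hc.le (by linarith))]
    congr 1; field_simp
  rw [e, ← lintegral_const_mul _ (by fun_prop)]
  refine setLIntegral_mono (by fun_prop) fun u hu => ?_
  have hu : 0 < u := hu
  rw [← ENNReal.ofReal_mul (mul_nonneg hc.le (by linarith))]
  refine ENNReal.ofReal_le_ofReal ?_
  rw [div_le_iff₀ hu]
  have h3 : Real.exp (-(c * h₂ * u)) =
      Real.exp (-(c * h₁ * u)) * Real.exp (-(c * (h₂ - h₁) * u)) := by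
    rw [← Real.exp_add]; congr 1; ring
  have h4 := Real.add_one_le_exp (-(c * (h₂ - h₁) * u))
  nlinarith [Real.exp_pos (-(c * h₁ * u))]

lemma le_lintegral_exp_sub (hc : 0 < c) {h₁ h₂ : ℝ} (h1 : 0 < h₁) (h12 : h₁ ≤ h₂) :
    ENNReal.ofReal ((h₂ - h₁) / h₂) ≤ ∫⁻ u in Set.Ioi (0 : ℝ),
      ENNReal.ofReal ((Real.exp (-(c * h₁ * u)) - Real.exp (-(c * h₂ * u))) / u) := by
  have h2 := h1.trans_le h12
  have e : ENNReal.ofReal ((h₂ - h₁) / h₂) = ENNReal.ofReal (c * (h₂ - h₁)) *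
      ∫⁻ u in Set.Ioi (0 : ℝ), ENNReal.ofReal (Real.exp (-(c * h₂ * u))) := by
    rw [lintegral_Ioi_exp_neg_mul (mul_pos hc h2), ← ENNReal.ofReal_mul
      (mul_nonneg hc.le (by linarith))]
    congr 1; field_simp
  rw [e, ← lintegral_const_mul _ (by fun_prop)]
  refine setLIntegral_mono (by fun_prop) fun u hu => ?_
  have hu : 0 < u := hu
  rw [← ENNReal.ofReal_mul (mul_nonneg hc.le (by linarith))]
  refine ENNReal.ofReal_le_ofReal ?_
  rw [le_div_iff₀ hu]
  have h3 : Real.exp (-(c * h₁ * u)) =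
      Real.exp (-(c * h₂ * u)) * Real.exp (c * (h₂ - h₁) * u) := by
    rw [← Real.exp_add]; congr 1; ring
  have h4 := Real.add_one_le_exp (c * (h₂ - h₁) * u)
  nlinarith [Real.exp_pos (-(c * h₂ * u))]

lemma lintegral_Ioi_ite_Ioc {x y : ℝ} (hx : 0 < x) (f : ℝ → ℝ≥0∞) :
    ∫⁻ u in Set.Ioi (0 : ℝ), (if x < u ∧ u ≤ y then f u else 0) = ∫⁻ u in Set.Ioc x y, f u := by
  have : ∀ u, (if x < u ∧ u ≤ y then f u else 0) = (Set.Ioc x y).indicator f u := fun u => by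
    simp [Set.indicator]
  simp_rw [this]
  have hsub : Set.Ioc x y ⊆ Set.Ioi 0 := fun u hu => hx.trans hu.1
  rw [lintegral_indicator measurableSet_Ioc, Measure.restrict_restrict measurableSet_Ioc,
    Set.inter_eq_left.2 hsub]

/-- The mean of the product of interference factors, normalised by the largest point. -/
theorem lintegral_infProd_expFactor_argmax (hp : IsPowerLawPPP p c γ P) (hβ : 0 < β)
    {T : Ω → ℝ≥0∞} (hT : ∀ᵐ ω ∂P, ∃ i, 0 < p i ω ∧ (∀ l, l ≠ i → p l ω < p i ω) ∧
      T ω = infProd fun l => expFactor (β * (p l ω / p i ω))) :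
    ∫⁻ ω, T ω ∂P = ENNReal.ofReal (1 / ((1 + β) * tailIntegral β γ 1)) := by
  have hγ := hp.exponent_pos
  have hc := hp.const_pos
  have hγ1 := hp.one_lt_exponent
  have h1pos : 0 < tailIntegral β γ 1 := tailIntegral_pos hβ one_pos
  have hTle : ∫⁻ ω, T ω ∂P ≤ 1 := by
    refine (lintegral_mono_ae (g := fun _ => 1) (hT.mono fun ω ⟨i, _, _, h⟩ => ?_)).trans (by simp)
    rw [h]; exact infProd_le_one _
  have hTfin : ∫⁻ ω, T ω ∂P ≠ ∞ := ne_top_of_le_ne_top ENNReal.one_ne_top hTle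
  set t := (∫⁻ ω, T ω ∂P).toReal with ht
  have htE : ∫⁻ ω, T ω ∂P = ENNReal.ofReal t := (ENNReal.ofReal_toReal hTfin).symm
  -- The window (m, m/a] lies above m, where u^γ p_l ≥ p_l/p_max and 1/u ≤ 1/m. The inner integral
  -- is thus at most T times length/m = 1/a - 1. Dividing by 1 - a gives the bound.
  have hlower : ∀ a ∈ Set.Ioo (0 : ℝ) 1,
      a * (a ^ γ / (a ^ γ + β)) / tailIntegral β γ 1 ≤ t := by
    rintro a ⟨ha, ha1⟩
    have h1 := le_lintegral_exp_sub hc (tailIntegral_pos (γ := γ) hβ ha)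
      (tailIntegral_mono hβ hγ1 ha ha1.le)
    rw [← hp.lintegral_lintegral_sub hβ ha ha1.le] at h1
    have h2 : ∫⁻ ω, (∫⁻ u in Set.Ioi (0 : ℝ), (infProd (fun l => truncFactor β γ a u (p l ω)) -
        infProd (fun l => truncFactor β γ 1 u (p l ω))) * ENNReal.ofReal (1 / u)) ∂P ≤
        ∫⁻ ω, T ω * ENNReal.ofReal (1 / a - 1) ∂P := by
      refine lintegral_mono_ae (hT.mono fun ω ⟨i, hi, hmax, hTω⟩ => ?_)
      set m := (p i ω) ^ (-γ⁻¹) with hm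
      have hmpos : 0 < m := Real.rpow_pos_of_pos hi _
      calc _ = ∫⁻ u in Set.Ioi (0 : ℝ), (if m < u ∧ u ≤ m / a then
            infProd (fun l => expFactor (β * u ^ γ * p l ω)) * ENNReal.ofReal (1 / u) else 0) := by
            refine setLIntegral_congr_fun measurableSet_Ioi fun u hu => ?_
            rw [infProd_truncFactor_sub_eq (q := fun l => p l ω) hγ hi hmax ha ha1.le hu]
            simp only [div_one, ite_mul, zero_mul, ← hm]
        _ = ∫⁻ u in Set.Ioc m (m / a),
            infProd (fun l => expFactor (β * u ^ γ * p l ω)) * ENNReal.ofReal (1 / u) :=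
            lintegral_Ioi_ite_Ioc hmpos _
        _ ≤ ∫⁻ u in Set.Ioc m (m / a), T ω * ENNReal.ofReal (1 / m) := by
            refine setLIntegral_mono (by fun_prop) fun u hu => ?_
            gcongr ?_ * ENNReal.ofReal ?_
            · rw [hTω]
              refine infProd_mono fun l => ?_
              rw [div_eq_inv_mul, ← mul_assoc]
              refine expFactor_mul_mono hβ.le (inv_nonneg.2 hi.le) ?_ _
              rw [← rpow_neg_inv_rpow hγ hi]
              exact Real.rpow_le_rpow hmpos.le hu.1.le hγ.le
            · exact one_div_le_one_div_of_le hmpos hu.1.le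
        _ = _ := by
            rw [setLIntegral_const, Real.volume_Ioc, mul_assoc, ← ENNReal.ofReal_mul (by positivity)]
            congr 2; field_simp
    rw [lintegral_mul_const' _ _ (by simp), htE, ← ENNReal.ofReal_mul ENNReal.toReal_nonneg] at h2
    have hinv : 0 < 1 / a - 1 := by rw [sub_pos, lt_div_iff₀ ha]; linarith
    have h3 := (ENNReal.ofReal_le_ofReal_iff (mul_nonneg ENNReal.toReal_nonneg hinv.le)).1
      (h1.trans h2)
    have h4 := le_tailIntegral_sub hβ hγ1 ha ha1.le
    have h5 : (1 - a) * (a ^ γ / (a ^ γ + β)) / tailIntegral β γ 1 ≤ t * (1 / a - 1) := by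
      refine le_trans ?_ h3
      gcongr
    have h6 : t * (1 / a - 1) = t * (1 - a) / a := by field_simp
    rw [h6, le_div_iff₀ ha] at h5
    refine le_of_mul_le_mul_right ?_ (sub_pos.2 ha1)
    calc _ = (1 - a) * (a ^ γ / (a ^ γ + β)) / tailIntegral β γ 1 * a := by ring
      _ ≤ _ := h5
  -- Mirror image: the window (m/b, m] lies below m, all inequalities reverse, and length/m = 1 -
  -- 1/b.
  have hupper : ∀ b ∈ Set.Ioi (1 : ℝ),
      t ≤ b * (b ^ γ / (b ^ γ + β)) / tailIntegral β γ 1 := by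
    intro b hb1
    have hb1 : 1 < b := hb1
    have hb : 0 < b := one_pos.trans hb1
    have h1 := lintegral_exp_sub_le hc h1pos (tailIntegral_mono hβ hγ1 one_pos hb1.le)
    rw [← hp.lintegral_lintegral_sub hβ one_pos hb1.le] at h1
    have h2 : ∫⁻ ω, T ω * ENNReal.ofReal (1 - 1 / b) ∂P ≤ ∫⁻ ω, (∫⁻ u in Set.Ioi (0 : ℝ),
        (infProd (fun l => truncFactor β γ 1 u (p l ω)) -
        infProd (fun l => truncFactor β γ b u (p l ω))) * ENNReal.ofReal (1 / u)) ∂P := by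
      refine lintegral_mono_ae (hT.mono fun ω ⟨i, hi, hmax, hTω⟩ => ?_)
      set m := (p i ω) ^ (-γ⁻¹) with hm
      have hmpos : 0 < m := Real.rpow_pos_of_pos hi _
      refine ge_iff_le.1 ?_
      calc _ = ∫⁻ u in Set.Ioi (0 : ℝ), (if m / b < u ∧ u ≤ m then
            infProd (fun l => expFactor (β * u ^ γ * p l ω)) * ENNReal.ofReal (1 / u) else 0) := by
            refine setLIntegral_congr_fun measurableSet_Ioi fun u hu => ?_
            rw [infProd_truncFactor_sub_eq (q := fun l => p l ω) hγ hi hmax one_pos hb1.le hu]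
            simp only [div_one, ite_mul, zero_mul, ← hm]
        _ = ∫⁻ u in Set.Ioc (m / b) m,
            infProd (fun l => expFactor (β * u ^ γ * p l ω)) * ENNReal.ofReal (1 / u) :=
            lintegral_Ioi_ite_Ioc (by positivity) _
        _ ≥ ∫⁻ u in Set.Ioc (m / b) m, T ω * ENNReal.ofReal (1 / m) := by
            refine setLIntegral_mono' measurableSet_Ioc fun u hu => ?_
            gcongr ?_ * ENNReal.ofReal ?_
            · rw [hTω]
              have hu0 := ((by positivity : 0 < m / b).trans hu.1).le
              refine infProd_mono fun l => ?_
              rw [div_eq_inv_mul, ← mul_assoc]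
              refine expFactor_mul_mono hβ.le (Real.rpow_nonneg hu0 _) ?_ _
              rw [← rpow_neg_inv_rpow hγ hi]
              exact Real.rpow_le_rpow hu0 hu.2 hγ.le
            · exact one_div_le_one_div_of_le ((by positivity : 0 < m / b).trans hu.1) hu.2
        _ = _ := by
            rw [setLIntegral_const, Real.volume_Ioc, mul_assoc, ← ENNReal.ofReal_mul (by positivity)]
            congr 2; field_simp
    rw [lintegral_mul_const' _ _ (by simp), htE, ← ENNReal.ofReal_mul ENNReal.toReal_nonneg] at h2
    have h3 := (ENNReal.ofReal_le_ofReal_iff (div_nonneg (sub_nonneg.2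
      (tailIntegral_mono hβ hγ1 one_pos hb1.le)) h1pos.le)).1 (h2.trans h1)
    have h4 := tailIntegral_sub_le hβ hγ1 one_pos hb1.le
    have h5 : t * (1 - 1 / b) ≤ (b - 1) * (b ^ γ / (b ^ γ + β)) / tailIntegral β γ 1 := by
      refine h3.trans ?_
      gcongr
    have h6 : t * (1 - 1 / b) = t * (b - 1) / b := by field_simp
    rw [h6, div_le_iff₀ hb] at h5
    refine le_of_mul_le_mul_right ?_ (sub_pos.2 hb1)
    calc _ ≤ _ := h5
      _ = _ := by ring
  -- The lower and upper bounds are the same function of the parameter, taken on the two sides of 1,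
  -- so continuity there pins down t.
  have hcont : ContinuousAt (fun x : ℝ => x * (x ^ γ / (x ^ γ + β)) / tailIntegral β γ 1) 1 := by
    have h1 : ContinuousAt (fun x : ℝ => x ^ γ) 1 :=
      Real.continuousAt_rpow_const _ _ (Or.inl one_ne_zero)
    have h2 : (1 : ℝ) ^ γ + β ≠ 0 := by rw [Real.one_rpow]; positivity
    exact (continuousAt_id.mul (h1.div (h1.add continuousAt_const) h2)).div_const _
  have hval : (1 : ℝ) * (1 ^ γ / (1 ^ γ + β)) / tailIntegral β γ 1 =
      1 / ((1 + β) * tailIntegral β γ 1) := by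
    rw [Real.one_rpow, one_mul, div_div]
  rw [htE]
  congr 1
  rw [← hval]
  refine le_antisymm ?_ ?_
  · refine ge_of_tendsto (hcont.tendsto.mono_left (nhdsWithin_le_nhds (s := Set.Ioi 1))) ?_
    exact eventually_mem_nhdsWithin.mono hupper
  · refine le_of_tendsto (hcont.tendsto.mono_left (nhdsWithin_le_nhds (s := Set.Iio 1))) ?_
    filter_upwards [Ioo_mem_nhdsLT (zero_lt_one' ℝ)] with a ha using hlower a ha

end IsPowerLawPPP

end PowerLaw

/-! ### Identification of H(1) with the hypergeometric expression. -/

section Hypergeometric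

open Filter Topology

/-- The substitution t = w^(-γ) maps (1, ∞) onto (0, 1). Indicators extend both integrands to (0,
∞), where the change of variables is stated. -/
lemma integral_Ioi_div_rpow_add {β γ : ℝ} (hβ : 0 < β) (hγ : 1 < γ) :
    γ * ∫ w in Set.Ioi (1 : ℝ), β / (w ^ γ + β) =
      ∫ t in (0 : ℝ)..1, β * (t ^ (-γ⁻¹) / (1 + β * t)) := by
  have hγ0 : 0 < γ := by linarith
  have h := integral_comp_rpow_Ioi
    (fun t : ℝ => (Set.Ioo (0 : ℝ) 1).indicator (fun t => β * (t ^ (-γ⁻¹) / (1 + β * t))) t)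
    (neg_ne_zero.2 hγ0.ne')
  rw [intervalIntegral.integral_of_le zero_le_one, integral_Ioc_eq_integral_Ioo,
    ← Set.inter_eq_right.2 (Set.Ioo_subset_Ioi_self : Set.Ioo (0 : ℝ) 1 ⊆ Set.Ioi 0),
    ← setIntegral_indicator measurableSet_Ioo, ← h,
    ← integral_const_mul]
  rw [← Set.inter_eq_right.2 (Set.Ioi_subset_Ioi (zero_le_one' ℝ)),
    ← setIntegral_indicator measurableSet_Ioi]
  refine setIntegral_congr_fun measurableSet_Ioi fun w hw => ?_
  have hw : 0 < w := hw
  simp only [Set.indicator, Set.mem_Ioi, Set.mem_Ioo, Real.rpow_pos_of_pos hw, true_and,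
    Real.rpow_lt_one_iff_of_pos hw, neg_pos, neg_lt_zero, hγ0, hγ0.not_gt, and_false, or_false,
    and_true, smul_eq_mul, abs_neg, abs_of_pos hγ0]
  split_ifs with h1
  · have hwp := Real.rpow_pos_of_pos hw γ
    rw [IsPowerLawPPP.rpow_neg_inv_rpow_neg hγ0.ne' hw.le, Real.rpow_sub hw, Real.rpow_one,
      Real.rpow_neg hw.le]
    field_simp
  · simp

/-- In Euler's integral c - b = 1 here, so the power of 1 - t is trivial and the Gamma quotient
reduces to b = 1 - 2/α. The prefactor 2β/(α-2) times b is β/γ with γ = α/2. -/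
lemma tailIntegral_one_eq {β α : ℝ} (hβ : 0 < β) (hα : 2 < α) :
    tailIntegral β (α / 2) 1 = 1 + coverageF β α := by
  have hα0 : 0 < α := by linarith
  have hb : 1 - 2 / α ≠ 0 := by
    have : 2 / α < 1 := by rw [div_lt_one hα0]; exact hα
    linarith
  have hbpos : 0 < 1 - 2 / α := by
    have : 2 / α < 1 := by rw [div_lt_one hα0]; exact hα
    linarith
  have h := integral_Ioi_div_rpow_add (γ := α / 2) hβ (by linarith)
  have hG : Real.Gamma (2 - 2 / α) = (1 - 2 / α) * Real.Gamma (1 - 2 / α) := by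
    rw [← Real.Gamma_add_one hb]; congr 1; ring
  have hG0 : Real.Gamma (1 - 2 / α) ≠ 0 := (Real.Gamma_pos_of_pos hbpos).ne'
  have hsub : 2 - 2 / α - (1 - 2 / α) = 1 := by ring
  have hI : ∫ t in (0 : ℝ)..1, β * (t ^ (-(α / 2)⁻¹) / (1 + β * t)) =
      β * ∫ t in (0 : ℝ)..1, t ^ (1 - 2 / α - 1) * (1 - t) ^ (2 - 2 / α - (1 - 2 / α) - 1) /
        (1 - t * -β) ^ (1 : ℝ) := by
    rw [← intervalIntegral.integral_const_mul]
    refine intervalIntegral.integral_congr fun t _ => ?_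
    simp only [hsub, sub_self, Real.rpow_zero, Real.rpow_one, mul_one]
    rw [show (-(α / 2)⁻¹) = 1 - 2 / α - 1 by rw [inv_div]; ring,
      show 1 - t * -β = 1 + β * t by ring]
  rw [hI] at h
  have h' : ∫ w in Set.Ioi (1 : ℝ), β / (w ^ (α / 2) + β) = coverageF β α := by
    rw [hsub] at h
    rw [coverageF, gaussHyp, hG, hsub, Real.Gamma_one, mul_one,
      mul_div_cancel_right₀ _ hG0]
    have h2 : α - 2 ≠ 0 := by linarith
    refine mul_left_cancel₀ (by linarith : α / 2 ≠ 0) ?_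
    rw [h]
    generalize ∫ t in (0 : ℝ)..1, t ^ (1 - 2 / α - 1) * (1 - t) ^ (1 - 1 : ℝ) /
        (1 - t * -β) ^ (1 : ℝ) = I
    field_simp
  rw [tailIntegral, h']

end Hypergeometric

/-! ### Reduction of radial integrals in the plane to the half-line. -/

section PlaneIntegral

/-- The disc k‖x‖² < t has area π t/k, linear in t; agreement on half-lines gives agreement on
half-open intervals, which determine the measure. -/
lemma map_sq_norm_plane {k : ℝ} (hk : 0 < k) :
    (volume : Measure Plane).map (fun x => k * ‖x‖ ^ 2) =
      ENNReal.ofReal (Real.pi / k) • (volume.restrict (Set.Ioi (0 : ℝ))) := by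
  have hm : Measurable fun x : Plane => k * ‖x‖ ^ 2 := by fun_prop
  have hball : ∀ t : ℝ, (volume : Measure Plane).map (fun x => k * ‖x‖ ^ 2) (Set.Iio t) =
      ENNReal.ofReal (Real.pi / k) * ENNReal.ofReal t := by
    intro t
    rw [Measure.map_apply hm measurableSet_Iio]
    have : (fun x : Plane => k * ‖x‖ ^ 2) ⁻¹' Set.Iio t = Metric.ball 0 (Real.sqrt (t / k)) := by
      ext x
      simp only [Set.mem_preimage, Set.mem_Iio, Metric.mem_ball, dist_zero_right]
      rw [Real.lt_sqrt (norm_nonneg _), lt_div_iff₀' hk]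
    rw [this, EuclideanSpace.volume_ball_fin_two]
    rcases le_total t 0 with ht | ht
    · rw [Real.sqrt_eq_zero_of_nonpos (div_nonpos_of_nonpos_of_nonneg ht hk.le),
        ENNReal.ofReal_of_nonpos ht]
      simp
    · rw [← ENNReal.ofReal_pow (Real.sqrt_nonneg _), Real.sq_sqrt (by positivity),
        ← ENNReal.ofReal_mul (by positivity), ← ENNReal.ofReal_mul (by positivity)]
      congr 1; ring
  have hball' : ∀ t : ℝ, (ENNReal.ofReal (Real.pi / k) • (volume.restrict (Set.Ioi (0 : ℝ))))
      (Set.Iio t) = ENNReal.ofReal (Real.pi / k) * ENNReal.ofReal t := by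
    intro t
    rw [Measure.smul_apply, Measure.restrict_apply measurableSet_Iio, Set.inter_comm,
      Set.Ioi_inter_Iio, Real.volume_Ioo, sub_zero, smul_eq_mul]
  have hfin : ∀ t : ℝ, ENNReal.ofReal (Real.pi / k) * ENNReal.ofReal t ≠ ∞ := fun t =>
    ENNReal.mul_ne_top ENNReal.ofReal_ne_top ENNReal.ofReal_ne_top
  have hIco : ∀ {a b : ℝ}, Set.Ico a b = Set.Iio b \ Set.Iio a := fun {a b} => by
    ext x; simp
  refine Measure.ext_of_Ico' _ _ (fun a b _ => ?_) fun a b hab => ?_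
  · refine ne_top_of_le_ne_top (hfin b) ?_
    rw [← hball b]
    exact measure_mono Set.Ico_subset_Iio_self
  · rw [hIco, measure_sdiff (Set.Iio_subset_Iio hab.le) measurableSet_Iio.nullMeasurableSet
        (by rw [hball]; exact hfin a),
      measure_sdiff (Set.Iio_subset_Iio hab.le) measurableSet_Iio.nullMeasurableSet
        (by rw [hball']; exact hfin a), hball, hball, hball', hball']

/-- In the variable v = k^(-2/α) ‖x‖² the path loss k‖x‖^(-α) becomes v^(-α/2). The gain k survives
only as the factor k^(2/α), which is why only the moment of order 2/α of the shadowing matters. -/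
lemma lintegral_plane_rpow_norm {α k : ℝ} (hα : 0 < α) (hk : 0 < k) {f : ℝ → ℝ≥0∞}
    (hf : Measurable f) :
    ∫⁻ x : Plane, f (k * ‖x‖ ^ (-α)) =
      ENNReal.ofReal (Real.pi * k ^ (2 / α)) *
        ∫⁻ v in Set.Ioi (0 : ℝ), f (v ^ (-(α / 2))) := by
  have hk' : 0 < k ^ (-(2 / α)) := Real.rpow_pos_of_pos hk _
  have h1 : ∀ x : Plane, k * ‖x‖ ^ (-α) = (k ^ (-(2 / α)) * ‖x‖ ^ 2) ^ (-(α / 2)) := by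
    intro x
    rw [Real.mul_rpow hk'.le (by positivity), ← Real.rpow_mul hk.le, ← Real.rpow_natCast,
      ← Real.rpow_mul (norm_nonneg _)]
    congr 2
    · have : -(2 / α) * -(α / 2) = 1 := by field_simp
      rw [this, Real.rpow_one]
    · push_cast; ring
  simp_rw [h1]
  have hm : Measurable fun v : ℝ => f (v ^ (-(α / 2))) := hf.comp (by fun_prop)
  rw [← lintegral_map (f := fun v : ℝ => f (v ^ (-(α / 2)))) hm
    (by fun_prop : Measurable fun x : Plane => k ^ (-(2 / α)) * ‖x‖ ^ 2),
    map_sq_norm_plane hk', lintegral_smul_measure, smul_eq_mul, Real.rpow_neg hk.le, div_inv_eq_mul]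

end PlaneIntegral

/-! ### The received powers as a power-law Poisson process. -/

namespace HetNet

variable {K : ℕ} {Ω : Type*} {N : HetNet K Ω}

/-- Long term received power of a BS if it is available, and zero otherwise. -/
noncomputable def activePower (N : HetNet K Ω) (b : Fin K × ℕ) (ω : Ω) : ℝ :=
  if N.on b.1 b.2 ω = true then N.avgPower ω b.1 b.2 else 0

/-- Contribution of a tier to the intensity of received powers. -/
noncomputable def tierConst (N : HetNet K Ω) (k : Fin K) : ℝ :=
  N.density k * (N.avail k * (Real.pi * N.power k ^ (2 / N.α) *
    ∫ s, s ^ (2 / N.α) ∂N.shadowLaw k))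

section Sources

/-- The σ-algebra generated by a set of sources of randomness. -/
@[reducible] def sourcesSigma (N : HetNet K Ω) (S : Set (Source K)) : MeasurableSpace Ω :=
  ⨆ s ∈ S, N.sourceSigma s

lemma sourceSigma_le_sourcesSigma {S : Set (Source K)} {s : Source K} (hs : s ∈ S) :
    N.sourceSigma s ≤ N.sourcesSigma S :=
  le_iSup₂ (f := fun s _ => N.sourceSigma s) s hs

variable {S : Set (Source K)} {k : Fin K} {i : ℕ}

lemma measurable_loc_sources (h : Source.locations k ∈ S) :
    Measurable[N.sourcesSigma S] (N.loc k i) := by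
  have h1 : Measurable[N.sourceSigma (.locations k)] (fun ω i => N.loc k i ω) :=
    comap_measurable _
  exact ((measurable_pi_apply i).comp h1).mono (sourceSigma_le_sourcesSigma h) le_rfl

lemma measurable_on_sources (h : Source.state k i ∈ S) :
    Measurable[N.sourcesSigma S] (N.on k i) :=
  (comap_measurable _).mono (sourceSigma_le_sourcesSigma h) le_rfl

lemma measurable_fading_sources (h : Source.fading k i ∈ S) :
    Measurable[N.sourcesSigma S] (N.fading k i) :=
  (comap_measurable _).mono (sourceSigma_le_sourcesSigma h) le_rfl

lemma measurable_shadow_sources (h : Source.shadowing k i ∈ S) :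
    Measurable[N.sourcesSigma S] (N.shadow k i) :=
  (comap_measurable _).mono (sourceSigma_le_sourcesSigma h) le_rfl

lemma measurable_activePower_of {m : MeasurableSpace Ω} {b : Fin K × ℕ}
    (h1 : Measurable (N.loc b.1 b.2)) (h2 : Measurable (N.on b.1 b.2))
    (h3 : Measurable (N.shadow b.1 b.2)) : Measurable (N.activePower b) := by
  unfold activePower avgPower
  refine Measurable.ite (h2 (measurableSet_singleton true)) ?_ measurable_const
  fun_prop

end Sources

namespace IsModel

variable [MeasurableSpace Ω] {P : Measure Ω}

lemma sourceSigma_le (hN : N.IsModel P) (s : Source K) : N.sourceSigma s ≤ ‹MeasurableSpace Ω› := by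
  cases s with
  | locations k =>
    exact (measurable_pi_lambda _ fun i => (hN.loc_ppp k).measurable i).comap_le
  | state k i => exact (hN.on_measurable k i).comap_le
  | fading k i => exact (hN.fading_measurable k i).comap_le
  | shadowing k i => exact (hN.shadow_measurable k i).comap_le

lemma indepFun_of_sources (hN : N.IsModel P) {S T : Set (Source K)} (hST : Disjoint S T)
    {D E : Type*} [MeasurableSpace D] [MeasurableSpace E] {Z : Ω → D} {M : Ω → E}
    (hZ : Measurable[N.sourcesSigma S] Z) (hM : Measurable[N.sourcesSigma T] M) :
    IndepFun Z M P := by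
  have h := indep_iSup_of_disjoint hN.sourceSigma_le hN.indep hST
  rw [IndepFun_iff_Indep]
  exact indep_of_indep_of_le_left (indep_of_indep_of_le_right h hM.comap_le) hZ.comap_le

lemma measurable_loc (hN : N.IsModel P) (k : Fin K) (i : ℕ) : Measurable (N.loc k i) :=
  (hN.loc_ppp k).measurable i

lemma measurable_activePower (hN : N.IsModel P) (b : Fin K × ℕ) : Measurable (N.activePower b) :=
  measurable_activePower_of (hN.measurable_loc _ _) (hN.on_measurable _ _) (hN.shadow_measurable _ _)

lemma iIndepFun_shadow (hN : N.IsModel P) :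
    iIndepFun (fun b : Fin K × ℕ => N.shadow b.1 b.2) P :=
  hN.indep.precomp (g := fun b : Fin K × ℕ => Source.shadowing b.1 b.2) fun b b' h => by
    simp only [Source.shadowing.injEq] at h; exact Prod.ext h.1 h.2

lemma iIndepFun_on (hN : N.IsModel P) : iIndepFun (fun b : Fin K × ℕ => N.on b.1 b.2) P :=
  hN.indep.precomp (g := fun b : Fin K × ℕ => Source.state b.1 b.2) fun b b' h => by
    simp only [Source.state.injEq] at h; exact Prod.ext h.1 h.2

lemma iIndepFun_fading (hN : N.IsModel P) : iIndepFun (fun b : Fin K × ℕ => N.fading b.1 b.2) P :=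
  hN.indep.precomp (g := fun b : Fin K × ℕ => Source.fading b.1 b.2) fun b b' h => by
    simp only [Source.fading.injEq] at h; exact Prod.ext h.1 h.2

lemma iIndepFun_loc (hN : N.IsModel P) : iIndepFun (fun (k : Fin K) ω (i : ℕ) => N.loc k i ω) P :=
  hN.indep.precomp (g := fun k : Fin K => Source.locations k) fun b b' h => by
    simpa using h

lemma α_pos (hN : N.IsModel P) : 0 < N.α := two_pos.trans hN.two_lt_α

lemma ofReal_avail_le_one (hN : N.IsModel P) (k : Fin K) : ENNReal.ofReal (N.avail k) ≤ 1 := by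
  simpa using (hN.avail_mem k).2

lemma tierConst_nonneg (hN : N.IsModel P) (k : Fin K) : 0 ≤ N.tierConst k := by
  have h : 0 ≤ ∫ s, s ^ (2 / N.α) ∂N.shadowLaw k :=
    integral_nonneg_of_ae ((hN.shadowLaw_nonneg k).mono fun s hs => Real.rpow_nonneg hs _)
  have := (hN.avail_mem k).1
  have := (hN.power_pos k).le
  unfold tierConst
  positivity

lemma tierConst_pos (hN : N.IsModel P) {k : Fin K} (h : 0 < N.avail k)
    (hs : 0 < N.shadowLaw k (Set.Ioi 0)) : 0 < N.tierConst k := by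
  have h : 0 < ∫ s, s ^ (2 / N.α) ∂N.shadowLaw k := by
    rw [integral_pos_iff_support_of_nonneg_ae
      ((hN.shadowLaw_nonneg k).mono fun s hs => Real.rpow_nonneg hs _) (hN.shadowLaw_moment k)]
    refine hs.trans_le (measure_mono fun s hs => ?_)
    exact (Real.rpow_pos_of_pos hs _).ne'
  have := hN.power_pos k
  have : 0 < (N.density k : ℝ) := hN.density_pos k
  unfold tierConst
  positivity

variable [IsProbabilityMeasure P]

lemma isProbabilityMeasure_shadowLaw (hN : N.IsModel P) (k : Fin K) :
    IsProbabilityMeasure (N.shadowLaw k) := by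
  rw [← hN.shadow_law k 0]
  exact Measure.isProbabilityMeasure_map (hN.shadow_measurable k 0).aemeasurable

lemma lintegral_on (hN : N.IsModel P) (k : Fin K) (i : ℕ) (f : Bool → ℝ≥0∞) :
    ∫⁻ o, f o ∂(P.map (N.on k i)) =
      ENNReal.ofReal (N.avail k) * f true + (1 - ENNReal.ofReal (N.avail k)) * f false := by
  have hm := hN.on_measurable k i
  have ht : P.map (N.on k i) {true} = ENNReal.ofReal (N.avail k) := by
    rw [Measure.map_apply hm (measurableSet_singleton _), ← hN.on_prob k i]; rfl
  have hf : P.map (N.on k i) {false} = 1 - ENNReal.ofReal (N.avail k) := by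
    have := Measure.isProbabilityMeasure_map (μ := P) hm.aemeasurable
    rw [← ht, ← prob_compl_eq_one_sub (measurableSet_singleton _)]
    congr 1; ext x; simp
  rw [lintegral_fintype, Fintype.sum_bool, ht, hf, mul_comm, mul_comm (f false)]

lemma one_sub_convex_comb {r y : ℝ≥0∞} (hr : r ≤ 1) (hy : y ≤ 1) :
    1 - (r * y + (1 - r) * 1) = r * (1 - y) := by
  refine ENNReal.sub_eq_of_eq_add ?_ ?_
  · refine ENNReal.add_ne_top.2 ⟨ENNReal.mul_ne_top ?_ ?_, by simp⟩
    · exact ne_top_of_le_ne_top ENNReal.one_ne_top hr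
    · exact ne_top_of_le_ne_top ENNReal.one_ne_top hy
  · rw [mul_one, ← add_assoc, ← mul_add, tsub_add_cancel_of_le hy, mul_one,
      add_tsub_cancel_of_le hr]

section Laplace

variable {g : ℝ → ℝ≥0∞}

/-- Averaged factor of an available BS of tier `k` at a given location. -/
noncomputable def shadowAverage (N : HetNet K Ω) (g : ℝ → ℝ≥0∞) (k : Fin K) (x : Plane) : ℝ≥0∞ :=
  ∫⁻ s, g (N.power k * s * ‖x‖ ^ (-N.α)) ∂N.shadowLaw k

lemma shadowAverage_le_one (hN : N.IsModel P) (hg1 : ∀ x, g x ≤ 1) (k : Fin K) (x : Plane) :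
    shadowAverage N g k x ≤ 1 := by
  have := hN.isProbabilityMeasure_shadowLaw k
  exact (lintegral_mono fun s => hg1 _).trans (by simp)

lemma measurable_shadowAverage (hN : N.IsModel P) (hg : Measurable g) (k : Fin K) :
    Measurable (shadowAverage N g k) := by
  have := hN.isProbabilityMeasure_shadowLaw k
  have h : Measurable fun z : Plane × ℝ => g (N.power k * z.2 * ‖z.1‖ ^ (-N.α)) :=
    hg.comp (by fun_prop)
  exact h.lintegral_prod_right'

/-- Averaged factor of a BS of tier `k` at a given location. -/
noncomputable def markAverage (N : HetNet K Ω) (g : ℝ → ℝ≥0∞) (k : Fin K) (x : Plane) : ℝ≥0∞ :=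
  ENNReal.ofReal (N.avail k) * shadowAverage N g k x + (1 - ENNReal.ofReal (N.avail k)) * 1

lemma markAverage_le_one (hN : N.IsModel P) (hg1 : ∀ x, g x ≤ 1) (k : Fin K) (x : Plane) :
    markAverage N g k x ≤ 1 := by
  have h := mul_le_of_le_one_right' (a := ENNReal.ofReal (N.avail k))
    (hN.shadowAverage_le_one hg1 k x)
  unfold markAverage
  rw [mul_one]
  exact (add_le_add_left h _).trans (add_tsub_cancel_of_le (hN.ofReal_avail_le_one k)).le

lemma measurable_markAverage (hN : N.IsModel P) (hg : Measurable g) (k : Fin K) :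
    Measurable (markAverage N g k) :=
  ((hN.measurable_shadowAverage hg k).const_mul _).add_const _

/-- Shadowing is averaged given locations and states, then the states given locations. What is left
is a product over locations alone, to which the Laplace functional of each tier applies. -/
lemma lintegral_infProd_activePower_eq (hN : N.IsModel P) (hg : Measurable g) (hg1 : ∀ x, g x ≤ 1)
    (hg0 : g 0 = 1) :
    ∫⁻ ω, infProd (fun b => g (N.activePower b ω)) ∂P =
      ∫⁻ ω, infProd (fun b : Fin K × ℕ => markAverage N g b.1 (N.loc b.1 b.2 ω)) ∂P := by
  have hpr := hN.isProbabilityMeasure_shadowLaw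
  let S₁ : Set (Source K) := {s | (∃ k, s = .locations k) ∨ ∃ k i, s = .state k i}
  let S₀ : Set (Source K) := {s | ∃ k, s = .locations k}
  have hZ1 : Measurable fun ω =>
      ((fun b : Fin K × ℕ => N.loc b.1 b.2 ω), (fun b : Fin K × ℕ => N.on b.1 b.2 ω)) :=
    (measurable_pi_lambda _ fun b => hN.measurable_loc _ _).prodMk
      (measurable_pi_lambda _ fun b => hN.on_measurable _ _)
  have hind1 : IndepFun (fun ω =>
      ((fun b : Fin K × ℕ => N.loc b.1 b.2 ω), (fun b : Fin K × ℕ => N.on b.1 b.2 ω)))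
      (fun ω (b : Fin K × ℕ) => N.shadow b.1 b.2 ω) P := by
    refine hN.indepFun_of_sources (S := S₁) (T := {s | ∃ k i, s = .shadowing k i}) ?_ ?_ ?_
    · rw [Set.disjoint_left]
      rintro s (⟨k, rfl⟩ | ⟨k, i, rfl⟩) ⟨k', i', h⟩ <;> cases h
    · refine @Measurable.prodMk _ (N.sourcesSigma S₁) _ _ _ _ _ _ ?_ ?_
      · refine @measurable_pi_lambda _ _ _ (N.sourcesSigma S₁) _ _ fun b => ?_
        exact measurable_loc_sources (Or.inl ⟨_, rfl⟩)
      · refine @measurable_pi_lambda _ _ _ (N.sourcesSigma S₁) _ _ fun b => ?_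
        exact measurable_on_sources (Or.inr ⟨_, _, rfl⟩)
    · refine @measurable_pi_lambda _ _ _ (N.sourcesSigma _) _ _ fun b => ?_
      exact measurable_shadow_sources ⟨_, _, rfl⟩
  have hset : ∀ b, MeasurableSet
      {z : ((Fin K × ℕ → Plane) × (Fin K × ℕ → Bool)) × ℝ | z.1.2 b = true} := by
    intro b
    have hm : Measurable fun z : ((Fin K × ℕ → Plane) × (Fin K × ℕ → Bool)) × ℝ => z.1.2 b := by
      fun_prop
    exact hm (measurableSet_singleton true)
  have h1 := lintegral_infProd_of_indepFun hZ1 (fun b => hN.shadow_measurable b.1 b.2) hind1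
    hN.iIndepFun_shadow (k := fun _ => 1) measurable_const (fun _ => le_rfl)
    (g := fun b z => g (if z.1.2 b = true then N.power b.1 * z.2 * ‖z.1.1 b‖ ^ (-N.α) else 0))
    (fun b => hg.comp (Measurable.ite (hset b) (by fun_prop) measurable_const))
    (fun b z => hg1 _)
  have hZ2 : Measurable fun ω => (fun b : Fin K × ℕ => N.loc b.1 b.2 ω) :=
    measurable_pi_lambda _ fun b => hN.measurable_loc _ _
  have hind2 : IndepFun (fun ω => (fun b : Fin K × ℕ => N.loc b.1 b.2 ω))
      (fun ω (b : Fin K × ℕ) => N.on b.1 b.2 ω) P := by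
    refine hN.indepFun_of_sources (S := S₀) (T := {s | ∃ k i, s = .state k i}) ?_ ?_ ?_
    · rw [Set.disjoint_left]
      rintro s ⟨k, rfl⟩ ⟨k', i', h⟩; cases h
    · refine @measurable_pi_lambda _ _ _ (N.sourcesSigma S₀) _ _ fun b => ?_
      exact measurable_loc_sources ⟨_, rfl⟩
    · refine @measurable_pi_lambda _ _ _ (N.sourcesSigma _) _ _ fun b => ?_
      exact measurable_on_sources ⟨_, _, rfl⟩
  have h2 := lintegral_infProd_of_indepFun hZ2 (fun b => hN.on_measurable b.1 b.2) hind2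
    hN.iIndepFun_on (k := fun _ => 1) measurable_const (fun _ => le_rfl)
    (g := fun b z => if z.2 = true then shadowAverage N g b.1 (z.1 b) else 1)
    (fun b => Measurable.ite (measurable_snd (measurableSet_singleton true))
      ((hN.measurable_shadowAverage hg b.1).comp ((measurable_pi_apply b).comp measurable_fst))
      measurable_const)
    (fun b z => by
      split_ifs
      · exact hN.shadowAverage_le_one hg1 _ _
      · exact le_rfl)
  simp only [one_mul] at h1 h2
  have e1 : ∀ (b : Fin K × ℕ) ω, ∫⁻ y, g (if N.on b.1 b.2 ω = true then
      N.power b.1 * y * ‖N.loc b.1 b.2 ω‖ ^ (-N.α) else 0) ∂(P.map (N.shadow b.1 b.2)) =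
      if N.on b.1 b.2 ω = true then shadowAverage N g b.1 (N.loc b.1 b.2 ω) else 1 := by
    intro b ω
    rw [hN.shadow_law]
    split_ifs
    · rfl
    · simp [hg0]
  simp only [e1] at h1
  simp only [hN.lintegral_on, if_true, Bool.false_eq_true, if_false] at h2
  exact h1.trans h2

/-- After exchanging the integrals over the plane and the shadowing, each gain s contributes the
same half-line integral, weighted by s^(2/α). -/
lemma lintegral_one_sub_markAverage (hN : N.IsModel P) (hg : Measurable g) (hg1 : ∀ x, g x ≤ 1)
    (hg0 : g 0 = 1) (k : Fin K) :
    N.density k * ∫⁻ x, 1 - markAverage N g k x = ENNReal.ofReal (N.tierConst k) *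
      ∫⁻ v in Set.Ioi (0 : ℝ), 1 - g (v ^ (-(N.α / 2))) := by
  have hpr := hN.isProbabilityMeasure_shadowLaw k
  set I := ∫⁻ v in Set.Ioi (0 : ℝ), 1 - g (v ^ (-(N.α / 2))) with hI
  have hα := hN.α_pos
  have hP := hN.power_pos k
  have hf : Measurable fun x => 1 - g x := measurable_const.sub hg
  have hF : Measurable fun z : Plane × ℝ => 1 - g (N.power k * z.2 * ‖z.1‖ ^ (-N.α)) :=
    hf.comp (by fun_prop)
  have h1 : ∀ x, 1 - markAverage N g k x = ENNReal.ofReal (N.avail k) *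
      ∫⁻ s, 1 - g (N.power k * s * ‖x‖ ^ (-N.α)) ∂N.shadowLaw k := by
    intro x
    rw [markAverage, one_sub_convex_comb (hN.ofReal_avail_le_one k)
      (hN.shadowAverage_le_one hg1 k x)]
    congr 1
    have hgm : Measurable fun s : ℝ => g (N.power k * s * ‖x‖ ^ (-N.α)) := hg.comp (by fun_prop)
    rw [lintegral_sub hgm _ (ae_of_all _ fun s => hg1 _)]
    · simp [shadowAverage]
    · exact ne_top_of_le_ne_top ENNReal.one_ne_top (hN.shadowAverage_le_one hg1 k x)
  have h2 : ∀ᵐ s ∂N.shadowLaw k, ∫⁻ x : Plane, 1 - g (N.power k * s * ‖x‖ ^ (-N.α)) =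
      ENNReal.ofReal (Real.pi * N.power k ^ (2 / N.α) * s ^ (2 / N.α)) * I := by
    filter_upwards [hN.shadowLaw_nonneg k] with s hs
    -- A BS with zero gain has power 0 and drops out because `g 0 = 1`.
    rcases hs.eq_or_lt with rfl | hs
    · have : (2 : ℝ) / N.α ≠ 0 := by positivity
      simp [hg0, Real.zero_rpow this]
    · rw [lintegral_plane_rpow_norm hα (mul_pos hP hs) hf, Real.mul_rpow hP.le hs.le, mul_assoc]
  have hmom : ∫⁻ s, ENNReal.ofReal (Real.pi * N.power k ^ (2 / N.α) * s ^ (2 / N.α))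
      ∂N.shadowLaw k = ENNReal.ofReal (Real.pi * N.power k ^ (2 / N.α) *
        ∫ s, s ^ (2 / N.α) ∂N.shadowLaw k) := by
    rw [← integral_const_mul, ofReal_integral_eq_lintegral_ofReal
      ((hN.shadowLaw_moment k).const_mul _)]
    filter_upwards [hN.shadowLaw_nonneg k] with s hs
    simp only [Pi.zero_apply]
    positivity
  simp_rw [h1]
  rw [lintegral_const_mul _ hF.lintegral_prod_right', lintegral_lintegral_swap hF.aemeasurable,
    lintegral_congr_ae h2, lintegral_mul_const _ (by fun_prop), hmom, tierConst,
    ENNReal.ofReal_mul (p := (N.density k : ℝ)) (NNReal.coe_nonneg _),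
    ENNReal.ofReal_mul (p := N.avail k) (hN.avail_mem k).1, ENNReal.ofReal_coe_nnreal]
  ring

/-- The long term powers received from the available BSs of all tiers form a Poisson process. -/
theorem isPowerLawPPP_activePower (hN : N.IsModel P)
    (hactive : ∃ k, 0 < N.avail k ∧ 0 < N.shadowLaw k (Set.Ioi 0)) :
    IsPowerLawPPP N.activePower (∑ k, N.tierConst k) (N.α / 2) P where
  measurable := hN.measurable_activePower
  const_pos := by
    obtain ⟨k, hk, hs⟩ := hactive
    exact Finset.sum_pos' (fun k _ => hN.tierConst_nonneg k)
      ⟨k, Finset.mem_univ k, hN.tierConst_pos hk hs⟩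
  one_lt_exponent := by have := hN.two_lt_α; linarith
  laplace := by
    intro g hg hg1 hg0
    rw [hN.lintegral_infProd_activePower_eq hg hg1 hg0]
    have hφ := hN.measurable_markAverage hg
    have hφ1 := hN.markAverage_le_one hg1
    -- Tiers are independent, so the expectation of the product splits over tiers and the exponents
    -- add: superposition of the tiers.
    have h1 : ∀ ω, infProd (fun b : Fin K × ℕ => markAverage N g b.1 (N.loc b.1 b.2 ω)) =
        ∏ k, infProd fun i => markAverage N g k (N.loc k i ω) := fun ω =>
      infProd_prod fun b => hφ1 _ _
    simp_rw [h1]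
    have hm : ∀ k, Measurable fun x : ℕ → Plane => infProd fun i => markAverage N g k (x i) :=
      fun k => measurable_infProd fun i => (hφ k).comp (measurable_pi_apply i)
    have h2 := lintegral_prod_eq_prod_lintegral_of_indepFun Finset.univ
      (fun k ω => infProd fun i => markAverage N g k (N.loc k i ω))
      (hN.iIndepFun_loc.comp (fun k x => infProd fun i => markAverage N g k (x i)) hm)
      (fun k => measurable_infProd fun i => (hφ k).comp (hN.measurable_loc k i))
    rw [h2]
    simp_rw [fun k => (hN.loc_ppp k).lintegral_infProd (hφ k) (hφ1 k),
      hN.lintegral_one_sub_markAverage hg hg1 hg0]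
    rw [← expNeg_sum, ← Finset.sum_mul, ENNReal.ofReal_sum_of_nonneg
      fun k _ => hN.tierConst_nonneg k]

end Laplace

end IsModel

end HetNet

/-! ### Integrals against the exponential law of the fading. -/

section Exponential

lemma lintegral_expMeasure_one {f : ℝ → ℝ≥0∞} (hf : Measurable f) :
    ∫⁻ y, f y ∂expMeasure 1 = ∫⁻ y in Set.Ioi (0 : ℝ), ENNReal.ofReal (Real.exp (-y)) * f y := by
  have hpdf : Measurable (exponentialPDF 1) :=
    (measurable_exponentialPDFReal 1).ennreal_ofReal
  have h : expMeasure 1 = volume.withDensity (exponentialPDF 1) := rfl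
  rw [h, lintegral_withDensity_eq_lintegral_mul _ hpdf hf, ← lintegral_indicator measurableSet_Ioi,
    lintegral_congr_ae]
  filter_upwards [compl_mem_ae_iff.2 (measure_singleton (μ := (volume : Measure ℝ)) 0)] with y hy
  simp only [Set.mem_compl_iff, Set.mem_singleton_iff] at hy
  simp only [Pi.mul_apply, exponentialPDF_eq, Set.indicator, Set.mem_Ioi, one_mul]
  rcases lt_or_gt_of_ne hy with h0 | h0
  · simp [h0.not_ge, h0.not_gt]
  · simp [h0.le, h0]

lemma expMeasure_one_lt_ofReal (Y : ℝ≥0∞) :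
    expMeasure 1 {y | Y < ENNReal.ofReal y} = expNeg Y := by
  have hm : MeasurableSet {y : ℝ | Y < ENNReal.ofReal y} :=
    measurableSet_lt measurable_const (by fun_prop)
  induction Y using ENNReal.recTopCoe with
  | top => simp [expNeg]
  | coe t =>
    rw [← lintegral_indicator_one hm, lintegral_expMeasure_one (measurable_one.indicator hm),
      ← ENNReal.ofReal_coe_nnreal, expNeg_ofReal t.coe_nonneg]
    have h1 : ∀ y : ℝ, ENNReal.ofReal (Real.exp (-y)) *
        {y : ℝ | ENNReal.ofReal t < ENNReal.ofReal y}.indicator 1 y =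
        (Set.Ioi (t : ℝ)).indicator (fun y => ENNReal.ofReal (Real.exp (-y))) y := by
      intro y
      have : ENNReal.ofReal t < ENNReal.ofReal y ↔ (t : ℝ) < y :=
        ENNReal.ofReal_lt_ofReal_iff_of_nonneg t.2
      by_cases hy : (t : ℝ) < y <;> simp [Set.indicator, hy, this, -ENNReal.ofReal_coe_nnreal]
    have hsub : Set.Ioi (t : ℝ) ⊆ Set.Ioi 0 := Set.Ioi_subset_Ioi t.2
    simp_rw [h1]
    rw [lintegral_indicator measurableSet_Ioi, Measure.restrict_restrict measurableSet_Ioi,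
      Set.inter_eq_left.2 hsub, ← ofReal_integral_eq_lintegral_ofReal,
      integral_exp_neg_Ioi]
    · have := exp_neg_integrableOn_Ioi (t : ℝ) one_pos
      simp only [neg_mul, one_mul] at this
      exact this
    · exact Filter.Eventually.of_forall fun y => (Real.exp_pos _).le

lemma lintegral_expNeg_mul_expMeasure_one (x : ℝ) :
    ∫⁻ y, expNeg (ENNReal.ofReal (y * x)) ∂expMeasure 1 = expFactor x := by
  rw [lintegral_expMeasure_one (f := fun y => expNeg (ENNReal.ofReal (y * x)))
    (measurable_expNeg.comp (by fun_prop))]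
  rcases le_total x 0 with hx | hx
  · rw [IsPowerLawPPP.expFactor_of_nonpos hx]
    have := lintegral_Ioi_exp_neg_mul one_pos
    simp only [one_mul, div_one, ENNReal.ofReal_one] at this
    rw [← this]
    refine setLIntegral_congr_fun measurableSet_Ioi fun y hy => ?_
    rw [ENNReal.ofReal_of_nonpos (mul_nonpos_of_nonneg_of_nonpos (le_of_lt hy) hx), expNeg_zero,
      mul_one]
  · rw [expFactor_of_nonneg hx, ← lintegral_Ioi_exp_neg_mul (by linarith)]
    refine setLIntegral_congr_fun measurableSet_Ioi fun y hy => ?_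
    have hy : 0 < y := hy
    rw [expNeg_ofReal (by positivity), ← ENNReal.ofReal_mul (Real.exp_pos _).le, ← Real.exp_add]
    congr 2; ring

end Exponential

/-! ### Coverage given the received powers. -/

namespace HetNet

variable {K : ℕ} {Ω : Type*} {N : HetNet K Ω}

/-- `q` has its strict maximum, which is positive, at `b`. -/
def IsStrictArgmax {ι : Type*} (q : ι → ℝ) (b : ι) : Prop :=
  0 < q b ∧ ∀ l, l ≠ b → q l < q b

lemma IsStrictArgmax.unique {ι : Type*} {q : ι → ℝ} {b b' : ι} (h : IsStrictArgmax q b)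
    (h' : IsStrictArgmax q b') : b = b' := by
  by_contra hne
  exact lt_asymm (h.2 b' (Ne.symm hne)) (h'.2 b hne)

lemma measurableSet_isStrictArgmax {ι : Type*} [Countable ι] (b : ι) :
    MeasurableSet {q : ι → ℝ | IsStrictArgmax q b} := by
  have : {q : ι → ℝ | IsStrictArgmax q b} =
      {q | 0 < q b} ∩ ⋂ l, ⋂ (_ : l ≠ b), {q | q l < q b} := by
    ext q; simp [IsStrictArgmax]
  rw [this]
  exact (measurableSet_lt measurable_const (measurable_pi_apply b)).inter
    (.iInter fun l => .iInter fun _ => measurableSet_lt (measurable_pi_apply l)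
      (measurable_pi_apply b))

/-- A positive strict maximum of the active powers is attained at an available BS, which is then the
candidate of its own tier; any other serving BS would have to be at least as strong. -/
lemma isServing_iff {ω : Ω} {b b' : Fin K × ℕ}
    (h : IsStrictArgmax (fun l => N.activePower l ω) b) : N.IsServing ω b' ↔ b' = b := by
  have hon : N.on b.1 b.2 ω = true := by
    by_contra hoff
    have := h.1
    simp [activePower, hoff] at this
  have hb : N.activePower b ω = N.avgPower ω b.1 b.2 := if_pos hon
  have hmax : ∀ (k : Fin K) (j : ℕ), N.on k j ω = true →
      N.avgPower ω k j ≤ N.avgPower ω b.1 b.2 := by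
    intro k j hj
    rw [← hb]
    rcases eq_or_ne (k, j) b with rfl | hne
    · exact hb.ge
    · have := h.2 _ hne
      simp only [activePower, hj, if_true] at this ⊢
      exact this.le
  have hcand : N.IsCandidate ω b.1 b.2 := ⟨hon, fun j hj => hmax _ _ hj⟩
  constructor
  · intro hs
    by_contra hne
    have h1 := h.2 b' hne
    have h2 := hs.2 _ _ hcand
    have h3 : N.activePower b' ω = N.avgPower ω b'.1 b'.2 := if_pos hs.1.1
    simp only [hb, h3] at h1
    exact absurd h2 (not_le.2 h1)
  · rintro rfl
    exact ⟨hcand, fun l j hlj => hmax l j hlj.1⟩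

/-- Interference-to-signal ratio without the small scale fading of the serving BS. -/
noncomputable def relInterference {ι : Type*} (β : ℝ) (b : ι) (q h : ι → ℝ) : ℝ≥0∞ :=
  ∑' l : {l // l ≠ b}, ENNReal.ofReal (h l * (β * (q l / q b)))

lemma rxPower_eq (ω : Ω) (b : Fin K × ℕ) (h : N.on b.1 b.2 ω = true) :
    N.rxPower ω b.1 b.2 = N.fading b.1 b.2 ω * N.activePower b ω := by
  rw [activePower, if_pos h, rxPower, avgPower]; ring

/-- Unavailable BSs have active power 0, so the sum may run over all indices other than `b`. -/
lemma interference_eq (ω : Ω) (b : Fin K × ℕ) :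
    N.interference ω b =
      ∑' l : {l // l ≠ b}, ENNReal.ofReal (N.fading l.1.1 l.1.2 ω * N.activePower l ω) := by
  classical
  have h1 : ∀ k : Fin K, ∑' i : {i : ℕ // N.on k i ω = true ∧ (k, i) ≠ b},
      ENNReal.ofReal (N.rxPower ω k i) = ∑' i : ℕ, {l | l ≠ b}.indicator
        (fun l : Fin K × ℕ => ENNReal.ofReal (N.fading l.1 l.2 ω * N.activePower l ω)) (k, i) := by
    intro k
    refine (tsum_subtype {i : ℕ | N.on k i ω = true ∧ (k, i) ≠ b}
      fun i => ENNReal.ofReal (N.rxPower ω k i)).trans (tsum_congr fun i => ?_)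
    simp only [Set.indicator, Set.mem_ofPred_eq]
    by_cases hne : (k, i) = b
    · simp [hne]
    · by_cases hon : N.on k i ω = true
      · rw [if_pos ⟨hon, hne⟩, if_pos hne, ← rxPower_eq ω (k, i) hon]
      · simp [hne, hon, activePower]
  rw [interference]
  simp_rw [h1]
  have h2 := ENNReal.tsum_prod (f := fun k i => {l | l ≠ b}.indicator
    (fun l : Fin K × ℕ => ENNReal.ofReal (N.fading l.1 l.2 ω * N.activePower l ω)) (k, i))
  rw [tsum_fintype (f := fun k : Fin K => ∑' i, {l | l ≠ b}.indicator
    (fun l : Fin K × ℕ => ENNReal.ofReal (N.fading l.1 l.2 ω * N.activePower l ω)) (k, i))] at h2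
  rw [← h2]
  exact (tsum_subtype {l | l ≠ b}
    fun l : Fin K × ℕ => ENNReal.ofReal (N.fading l.1 l.2 ω * N.activePower l ω)).symm

lemma lt_SIR_iff {ω : Ω} {b : Fin K × ℕ} {β : ℝ} (hβ : 0 < β)
    (h : IsStrictArgmax (fun l => N.activePower l ω) b) :
    ENNReal.ofReal β < N.SIR ω b ↔
      relInterference β b (fun l => N.activePower l ω) (fun l => N.fading l.1 l.2 ω) <
        ENNReal.ofReal (N.fading b.1 b.2 ω) := by
  have hb : 0 < N.activePower b ω := h.1
  have hon : N.on b.1 b.2 ω = true := by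
    by_contra hoff
    simp [activePower, hoff] at hb
  have hq0 : ENNReal.ofReal (N.activePower b ω) ≠ 0 := by simpa using hb
  have hrel : relInterference β b (fun l => N.activePower l ω) (fun l => N.fading l.1 l.2 ω) =
      ENNReal.ofReal β * N.interference ω b / ENNReal.ofReal (N.activePower b ω) := by
    rw [relInterference, interference_eq, ← ENNReal.tsum_mul_left, div_eq_mul_inv,
      ← ENNReal.tsum_mul_right]
    refine tsum_congr fun l => ?_
    rw [← ENNReal.ofReal_mul hβ.le, ← ENNReal.ofReal_inv_of_pos hb, ← ENNReal.ofReal_mul' (by positivity)]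
    congr 1
    ring
  -- Since `β` is nonzero and the signal finite, clearing the denominator is valid even if the
  -- interference is 0 or ∞.
  rw [SIR, ENNReal.lt_div_iff_mul_lt (Or.inr ENNReal.ofReal_ne_top) (Or.inr (by simpa using hβ)),
    rxPower_eq ω b hon, hrel, ENNReal.div_lt_iff (Or.inl hq0) (Or.inl ENNReal.ofReal_ne_top),
    ENNReal.ofReal_mul' hb.le]

namespace IsModel

variable [MeasurableSpace Ω] {P : Measure Ω} [IsProbabilityMeasure P]

/-- Conditional coverage probability given the received powers, on the event that `b` serves. -/
lemma measure_argmax_inter_lt (hN : N.IsModel P) {β : ℝ} (hβ : 0 < β) (b : Fin K × ℕ) :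
    P {ω | IsStrictArgmax (fun l => N.activePower l ω) b ∧
      relInterference β b (fun l => N.activePower l ω) (fun l => N.fading l.1 l.2 ω) <
        ENNReal.ofReal (N.fading b.1 b.2 ω)} =
      ENNReal.ofReal (1 + β) * ∫⁻ ω, {ω | IsStrictArgmax (fun l => N.activePower l ω) b}.indicator
        (fun ω => infProd fun l => expFactor (β * (N.activePower l ω / N.activePower b ω))) ω ∂P := by
  classical
  set p : Ω → Fin K × ℕ → ℝ := fun ω l => N.activePower l ω with hp
  have hpm : Measurable p := measurable_pi_lambda _ hN.measurable_activePower
  set k : (Fin K × ℕ → ℝ) → ℝ≥0∞ := {q | IsStrictArgmax q b}.indicator 1 with hk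
  have hkm : Measurable k := measurable_one.indicator (measurableSet_isStrictArgmax b)
  have hk1 : ∀ q, k q ≤ 1 := fun q => Set.indicator_le_self' (fun _ _ => zero_le) q
  let S : Set (Source K) := {s | (∃ j, s = .locations j) ∨ (∃ j i, s = .state j i) ∨
    ∃ j i, s = .shadowing j i}
  have hpS : Measurable[N.sourcesSigma S] p := by
    refine @measurable_pi_lambda _ _ _ (N.sourcesSigma S) _ _ fun l => ?_
    exact @measurable_activePower_of _ _ _ (N.sourcesSigma S) _
      (measurable_loc_sources (Or.inl ⟨_, rfl⟩))
      (measurable_on_sources (Or.inr (Or.inl ⟨_, _, rfl⟩)))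
      (measurable_shadow_sources (Or.inr (Or.inr ⟨_, _, rfl⟩)))
  -- The fading of `b` is separated from everything else, including the other fadings, so that it
  -- can be integrated out first.
  let S' : Set (Source K) := {.fading b.1 b.2}
  have hSS' : Disjoint S'ᶜ S' := disjoint_compl_left
  have hpS' : Measurable[N.sourcesSigma S'ᶜ] p := by
    refine hpS.mono (biSup_mono ?_) le_rfl
    rintro s (⟨j, rfl⟩ | ⟨j, i, rfl⟩ | ⟨j, i, rfl⟩) <;> simp [S']
  let Z : Ω → (Fin K × ℕ → ℝ) × ({l // l ≠ b} → ℝ) := fun ω => (p ω, fun l => N.fading l.1.1 l.1.2 ω)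
  have hZ : Measurable Z := hpm.prodMk (measurable_pi_lambda _ fun l => hN.fading_measurable _ _)
  have hZS : Measurable[N.sourcesSigma S'ᶜ] Z := by
    refine @Measurable.prodMk _ (N.sourcesSigma S'ᶜ) _ _ _ _ _ _ hpS' ?_
    refine @measurable_pi_lambda _ _ _ (N.sourcesSigma S'ᶜ) _ _ fun l => ?_
    refine measurable_fading_sources ?_
    simp only [S', Set.mem_compl_iff, Set.mem_singleton_iff, Source.fading.injEq]
    exact fun h => l.2 (Prod.ext h.1 h.2)
  have hindb : IndepFun Z (N.fading b.1 b.2) P :=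
    hN.indepFun_of_sources hSS' hZS (measurable_fading_sources rfl)
  let Y : (Fin K × ℕ → ℝ) × ({l // l ≠ b} → ℝ) → ℝ≥0∞ := fun z =>
    ∑' l : {l // l ≠ b}, ENNReal.ofReal (z.2 l * (β * (z.1 l / z.1 b)))
  have hY : Measurable Y := by
    refine Measurable.tsum fun l => ?_
    fun_prop
  have hms : MeasurableSet {x : ((Fin K × ℕ → ℝ) × ({l // l ≠ b} → ℝ)) × ℝ |
      Y x.1 < ENNReal.ofReal x.2} :=
    measurableSet_lt (hY.comp measurable_fst) (by fun_prop)
  have hF : Measurable fun x : ((Fin K × ℕ → ℝ) × ({l // l ≠ b} → ℝ)) × ℝ =>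
      k x.1.1 * {x : ((Fin K × ℕ → ℝ) × ({l // l ≠ b} → ℝ)) × ℝ |
        Y x.1 < ENNReal.ofReal x.2}.indicator 1 x :=
    (hkm.comp (measurable_fst.comp measurable_fst)).mul (measurable_one.indicator hms)
  have hEm : MeasurableSet {ω | IsStrictArgmax (p ω) b ∧
      Y (Z ω) < ENNReal.ofReal (N.fading b.1 b.2 ω)} :=
    (hpm (measurableSet_isStrictArgmax b)).inter
      ((hZ.prodMk (hN.fading_measurable b.1 b.2)) hms)
  -- An exponential variable exceeds an independent Y with conditional probability exp(-Y), and this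
  -- is where Rayleigh fading linearises the problem.
  have hfading_b : P {ω | IsStrictArgmax (p ω) b ∧ Y (Z ω) < ENNReal.ofReal (N.fading b.1 b.2 ω)} =
      ∫⁻ ω, k (p ω) * expNeg (Y (Z ω)) ∂P := by
    rw [← lintegral_indicator_one hEm]
    have h1 := hindb.lintegral_comp_prodMk hZ (hN.fading_measurable b.1 b.2) hF
    rw [hN.fading_law] at h1
    refine Eq.trans (lintegral_congr fun ω => ?_) (h1.trans (lintegral_congr fun ω => ?_))
    · by_cases h1 : IsStrictArgmax (p ω) b <;>
        by_cases h2 : Y (Z ω) < ENNReal.ofReal (N.fading b.1 b.2 ω) <;>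
          simp [hk, Set.indicator, h1, h2, Z]
    · have hmi : MeasurableSet {y : ℝ | Y (Z ω) < ENNReal.ofReal y} :=
        measurableSet_lt measurable_const (by fun_prop)
      have h2 : ∀ y, {x : ((Fin K × ℕ → ℝ) × ({l // l ≠ b} → ℝ)) × ℝ |
          Y x.1 < ENNReal.ofReal x.2}.indicator
            (1 : ((Fin K × ℕ → ℝ) × ({l // l ≠ b} → ℝ)) × ℝ → ℝ≥0∞) (Z ω, y) =
          {y : ℝ | Y (Z ω) < ENNReal.ofReal y}.indicator 1 y := fun y => rfl
      simp_rw [h2]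
      rw [lintegral_const_mul _ (measurable_one.indicator hmi), lintegral_indicator_one hmi,
        expMeasure_one_lt_ofReal]
  have hexp : ∀ ω, expNeg (Y (Z ω)) = infProd fun l => if l = b then 1 else
      expNeg (ENNReal.ofReal (N.fading l.1 l.2 ω * (β * (p ω l / p ω b)))) := by
    intro ω
    have h1 : Y (Z ω) = ∑' l, {l | l ≠ b}.indicator (fun l : Fin K × ℕ =>
        ENNReal.ofReal (N.fading l.1 l.2 ω * (β * (p ω l / p ω b)))) l :=
      tsum_subtype {l | l ≠ b} fun l : Fin K × ℕ =>
        ENNReal.ofReal (N.fading l.1 l.2 ω * (β * (p ω l / p ω b)))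
    rw [h1, expNeg_tsum]
    congr 1; ext l
    by_cases hl : l = b <;> simp [Set.indicator, hl, expNeg_zero]
  have hindf : IndepFun p (fun ω (l : Fin K × ℕ) => N.fading l.1 l.2 ω) P := by
    refine hN.indepFun_of_sources (S := S) (T := {s | ∃ j i, s = .fading j i}) ?_ hpS ?_
    · rw [Set.disjoint_left]
      rintro s (⟨j, rfl⟩ | ⟨j, i, rfl⟩ | ⟨j, i, rfl⟩) ⟨j', i', h⟩ <;> cases h
    · refine @measurable_pi_lambda _ _ _ (N.sourcesSigma _) _ _ fun l => ?_
      exact measurable_fading_sources ⟨_, _, rfl⟩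
  have hgm : ∀ l : Fin K × ℕ, Measurable fun z : (Fin K × ℕ → ℝ) × ℝ =>
      if l = b then (1 : ℝ≥0∞) else expNeg (ENNReal.ofReal (z.2 * (β * (z.1 l / z.1 b)))) := by
    intro l
    by_cases hl : l = b
    · simp only [hl, if_true]; exact measurable_const
    · simp only [hl, if_false]
      exact measurable_expNeg.comp (by fun_prop)
  -- The other fadings are averaged factor by factor; the index `b` is kept with factor 1 so that
  -- the product runs over a fixed index type.
  have hfading_others := lintegral_infProd_of_indepFun hpm (fun l => hN.fading_measurable l.1 l.2) hindf
    hN.iIndepFun_fading hkm hk1 hgm (fun l z => by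
      split_ifs
      · exact le_rfl
      · exact expNeg_le_one _)
  have hpr := isProbabilityMeasure_expMeasure one_pos
  have havg : ∀ (l : Fin K × ℕ) ω, ∫⁻ y, (if l = b then (1 : ℝ≥0∞) else
      expNeg (ENNReal.ofReal (y * (β * (p ω l / p ω b))))) ∂(P.map (N.fading l.1 l.2)) =
      if l = b then 1 else expFactor (β * (p ω l / p ω b)) := by
    intro l ω
    rw [hN.fading_law]
    split_ifs
    · simp
    · exact lintegral_expNeg_mul_expMeasure_one _
  simp only [havg] at hfading_others
  change P {ω | IsStrictArgmax (p ω) b ∧ Y (Z ω) < ENNReal.ofReal (N.fading b.1 b.2 ω)} = _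
  rw [hfading_b]
  simp_rw [hexp]
  rw [hfading_others, ← lintegral_const_mul' _ _ ENNReal.ofReal_ne_top]
  refine lintegral_congr fun ω => ?_
  by_cases h : IsStrictArgmax (p ω) b
  · have hself : β * (p ω b / p ω b) = β := by rw [div_self h.1.ne', mul_one]
    -- At l = b the ratio of powers is 1, so completing the product introduces exactly 1/(1 + β).
    have hmul : ENNReal.ofReal (1 + β) * expFactor β = 1 := by
      rw [expFactor_of_nonneg hβ.le, ← ENNReal.ofReal_mul (by positivity),
        mul_one_div_cancel (by positivity), ENNReal.ofReal_one]
    have hsplit := infProd_eq_mul (a := fun l => expFactor (β * (p ω l / p ω b))) b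
      fun l => expFactor_le_one _
    rw [hself] at hsplit
    rw [Set.indicator_of_mem (show ω ∈ {ω | IsStrictArgmax (p ω) b} from h), hk,
      Set.indicator_of_mem (show p ω ∈ {q | IsStrictArgmax q b} from h), Pi.one_apply, one_mul,
      hsplit, ← mul_assoc, hmul, one_mul]
  · rw [Set.indicator_of_notMem (show ω ∉ {ω | IsStrictArgmax (p ω) b} from h), hk,
      Set.indicator_of_notMem (show p ω ∉ {q | IsStrictArgmax q b} from h), zero_mul, mul_zero]

end IsModel

end HetNet

/-! ### The coverage theorem. -/

theorem mainTheorem5 {K : ℕ} {Ω : Type*} [MeasurableSpace Ω] (P : Measure Ω)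
    [IsProbabilityMeasure P] (N : HetNet K Ω) (hN : N.IsModel P)
    (hactive : ∃ k, 0 < N.avail k ∧ 0 < N.shadowLaw k (Set.Ioi 0))
    (β : ℝ) (hβ : 0 < β) :
    (∀ᵐ ω ∂P, ∃! b : Fin K × ℕ, N.IsServing ω b) ∧
      P.real (N.coverageEvent β) = 1 / (1 + coverageF β N.α) := by
  classical
  have hppp := hN.isPowerLawPPP_activePower hactive
  have hargmax : ∀ᵐ ω ∂P, ∃ b, HetNet.IsStrictArgmax (fun l => N.activePower l ω) b :=
    hppp.ae_exists_strict_argmax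
  refine ⟨?_, ?_⟩
  · filter_upwards [hargmax] with ω ⟨b, hb⟩
    exact ⟨b, (HetNet.isServing_iff hb).2 rfl, fun b' hb' => (HetNet.isServing_iff hb).1 hb'⟩
  let A : Fin K × ℕ → Set Ω := fun b => {ω | HetNet.IsStrictArgmax (fun l => N.activePower l ω) b}
  let E : Fin K × ℕ → Set Ω := fun b => {ω | HetNet.IsStrictArgmax (fun l => N.activePower l ω) b ∧
      HetNet.relInterference β b (fun l => N.activePower l ω) (fun l => N.fading l.1 l.2 ω) <
        ENNReal.ofReal (N.fading b.1 b.2 ω)}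
  have hpm : Measurable fun ω l => N.activePower l ω :=
    measurable_pi_lambda _ hN.measurable_activePower
  have hA : ∀ b, MeasurableSet (A b) := fun b => hpm (HetNet.measurableSet_isStrictArgmax b)
  have hE : ∀ b, MeasurableSet (E b) := by
    intro b
    refine (hA b).inter (measurableSet_lt ?_ (hN.fading_measurable _ _).ennreal_ofReal)
    refine Measurable.tsum fun l => Measurable.ennreal_ofReal ?_
    exact (hN.fading_measurable _ _).mul (((hN.measurable_activePower _).div
      (hN.measurable_activePower _)).const_mul β)
  have hdisj : Pairwise (Function.onFun Disjoint E) := by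
    intro b b' hne
    rw [Function.onFun, Set.disjoint_left]
    exact fun ω h h' => hne (h.1.unique h'.1)
  -- Equality up to a null set suffices, so measurability of the coverage event itself is not
  -- needed.
  have hcov : N.coverageEvent β =ᵐ[P] ⋃ b, E b := by
    filter_upwards [hargmax] with ω ⟨b, hb⟩
    refine propext ?_
    change (∃ b, N.IsServing ω b ∧ ENNReal.ofReal β < N.SIR ω b) ↔ ω ∈ ⋃ b, E b
    simp only [HetNet.isServing_iff hb, exists_eq_left, Set.mem_iUnion]
    rw [HetNet.lt_SIR_iff hβ hb]
    refine ⟨fun h => ⟨b, hb, h⟩, ?_⟩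
    rintro ⟨b', hb', h⟩
    rwa [hb.unique hb']
  let G : Fin K × ℕ → Ω → ℝ≥0∞ := fun b ω =>
    infProd fun l => expFactor (β * (N.activePower l ω / N.activePower b ω))
  have hG : ∀ b, Measurable (G b) := fun b => measurable_infProd fun l =>
    measurable_expFactor.comp (((hN.measurable_activePower _).div
      (hN.measurable_activePower _)).const_mul β)
  -- The sum over b has a single nonzero term, at the argmax; this makes the normalised product a
  -- measurable sum without a measurable choice of the serving BS.
  have hT := hppp.lintegral_infProd_expFactor_argmax hβ (T := fun ω => ∑' b, (A b).indicator (G b) ω)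
    (by
      filter_upwards [hargmax] with ω ⟨b, hb⟩
      refine ⟨b, hb.1, hb.2, ?_⟩
      rw [tsum_eq_single b]
      · exact Set.indicator_of_mem (show ω ∈ A b from hb) _
      · intro b' hne
        refine Set.indicator_of_notMem (fun h => hne ?_) _
        have h' : HetNet.IsStrictArgmax (fun l => N.activePower l ω) b' := h
        exact h'.unique hb)
  have hH := tailIntegral_one_eq hβ hN.two_lt_α
  have hHpos : 0 < tailIntegral β (N.α / 2) 1 := tailIntegral_pos hβ one_pos
  -- Summing the conditional formula over the disjoint events gives (1 + β) E[T], and the two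
  -- factors 1 + β cancel.
  have hP : P (N.coverageEvent β) = ENNReal.ofReal (1 / tailIntegral β (N.α / 2) 1) := by
    rw [measure_congr hcov, measure_iUnion hdisj hE]
    simp_rw [E, hN.measure_argmax_inter_lt hβ]
    rw [ENNReal.tsum_mul_left, ← lintegral_tsum fun b => ((hG b).indicator (hA b)).aemeasurable, hT,
      ← ENNReal.ofReal_mul (by positivity)]
    congr 1
    field_simp
  rw [measureReal_def, hP, ENNReal.toReal_ofReal (by positivity), hH]
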